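/- **Soft-attention transformers and next-symbol cross-entropy for Parity and 2Dyck.** A soft-attention transformer over a finite symbol set has a number $L$ of layers and a number $H$ of heads that do not depend on the input length. On an input $x_1\dots x_n$ it computes $y_i^{(0)}=f(v(x_i),p_i)$ from embeddings $v(x_i)$ of the symbols and a bounded sequence of positional embeddings $p_1,p_2,\dots$ in $\mathbb R^k$; then, for $\ell=1,\dots,L$, $y_i^{(\ell)}=f^{act}_\ell\big(y_i^{(\ell-1)},b_{i,\ell,1},\dots,b_{i,\ell,H}\big)$ with $b_{i,\ell,h}=\sum_j \hat a_{i,j}\,y_j^{(\ell-1)}$, where $\hat a_{i,\cdot}$ is the softmax over $j$ of the scores $f^{att}_{\ell,h}(y_i^{(\ell-1)},y_j^{(\ell-1)})$. Here $f, f^{att}_{\ell,h}, f^{act}_\ell$ are arbitrary continuous functions (e.g. addition or concatenation, dot-product or additive attention, ReLU networks with skip connections). The predicted distribution is the softmax of a continuous function of the last activation $y_n^{(L)}$. To predict the symbol that follows a prefix, the transformer reads the prefix followed by an end-of-sequence symbol and predicts at the position of the latter. Let $0<p<1$. *Parity distribution:* bit strings generated by a two-state automaton that, if the number of 1s emitted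 so far is even, terminates with probability $p$ and otherwise emits 0 or 1 with probability $(1-p)/2$ each, and, if that number is odd, emits 0 or 1 with probability $1/2$ each. *2Dyck distribution:* words generated by the probabilistic context-free grammar $S\to (S)S$ and $S\to [S]S$, each with probability $p/2$, and $S\to\epsilon$ with probability $1-p$ (conditioned on termination if $p>1/2$). For such a word distribution let $X_n$ be the prefix of length $n$ of a random word conditioned to have length at least $n$, and let $Y_n$ be the symbol that follows it (a letter, or EndOfSequence if the word ends there). The cross-entropy at length $n$ of a transformer with predictions $q(\cdot\mid x)$ is $\mathrm{CE}_n=\mathbb E[-\log q(Y_n\mid X_n)]$. The optimal cross-entropy is that of the true conditional distribution of $Y_n$ given $X_n$. The unigram distribution $u_n$ is the marginal distribution of $Y_n$, and the unigram chance level is its entropy $h_n$, the cross-entropy of the best prediction that ignores the prefix. (1) *Parity.* For every soft-attention transformer, $\mathrm{CE}_n-\mathbb E[-\log q(Y'_n\mid X_n)]\to 0$ as $n\to\infty$, where $Y'_n$ is drawn from $u_n$ independently of $X_n$; that is, the transformer asymptotically performs only as if the next symbol were independent of the prefix. In particular it is never asymptotically better than chance: for every $\delta>0$, $\mathrm{CE}_n\ge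 h_n-\delta$ for all sufficiently large $n$. The chance level is attained: there is a soft-attention transformer with $\mathrm{CE}_n-h_n\to0$. (2) *2Dyck.* There is a constant $\varepsilon>0$, depending only on $p$, such that for every soft-attention transformer and all sufficiently large $n$, $\mathrm{CE}_n$ is at least $\varepsilon$ above the optimal cross-entropy at length $n$. The same holds if the transformer reads only the prefix and predicts at the position of its last symbol. -/

import Mathlib

open Filter Topology
open scoped ENNReal

noncomputable section

namespace SoftAttention

/-! ### Soft-attention transformers -/

/-- The softmax of a finite family of real scores. -/
def softmax {ι : Type} [Fintype ι] (a : ι → ℝ) (j : ι) : ℝ :=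
  Real.exp (a j) / ∑ j', Real.exp (a j')

/-- A soft-attention transformer over the finite symbol set `V` (its input symbols, and also the
symbols among which it predicts). The numbers of layers and heads, the dimensions and all
component functions are fixed independently of the input length.

The component functions are arbitrary continuous functions. This covers in particular addition or
concatenation of embeddings, dot-product and additive attention, fully connected (ReLU) networks
with skip connections, linear value maps, and a (ReLU) network before the output softmax.
The positional embeddings are an arbitrary bounded sequence. -/
structure SoftTransformer (V : Type) where
  /-- dimension of the input and positional embeddings -/
  embDim : ℕ
  /-- dimension of the activations -/
  dim : ℕ
  /-- number of layers -/
  layers : ℕ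
  /-- number of attention heads in each layer -/
  heads : ℕ
  /-- input embeddings -/
  embed : V → EuclideanSpace ℝ (Fin embDim)
  /-- positional embeddings -/
  pos : ℕ → EuclideanSpace ℝ (Fin embDim)
  pos_bounded : ∃ B : ℝ, ∀ i, ‖pos i‖ ≤ B
  /-- combination of an input embedding and a positional embedding -/
  combine : EuclideanSpace ℝ (Fin embDim) → EuclideanSpace ℝ (Fin embDim) →
    EuclideanSpace ℝ (Fin dim)
  combine_cont : Continuous (fun z : EuclideanSpace ℝ (Fin embDim) ×
    EuclideanSpace ℝ (Fin embDim) => combine z.1 z.2)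
  /-- attention score of head `h` in layer `k + 1`; only `k < layers` is used -/
  att : (k : ℕ) → (h : Fin heads) → EuclideanSpace ℝ (Fin dim) → EuclideanSpace ℝ (Fin dim) → ℝ
  att_cont : ∀ k h, Continuous (fun z : EuclideanSpace ℝ (Fin dim) ×
    EuclideanSpace ℝ (Fin dim) => att k h z.1 z.2)
  /-- position-wise activation function of layer `k + 1`; only `k < layers` is used -/
  act : (k : ℕ) → EuclideanSpace ℝ (Fin dim) → (Fin heads → EuclideanSpace ℝ (Fin dim)) →
    EuclideanSpace ℝ (Fin dim)
  act_cont : ∀ k, Continuous (fun z : EuclideanSpace ℝ (Fin dim) ×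
    (Fin heads → EuclideanSpace ℝ (Fin dim)) => act k z.1 z.2)
  /-- logits of the prediction, computed from the last activation -/
  readout : EuclideanSpace ℝ (Fin dim) → V → ℝ
  readout_cont : Continuous readout

namespace SoftTransformer

variable {V : Type}

/-- The activations of layer `k` on the input `x`, one for each position. -/
def activation (T : SoftTransformer V) {n : ℕ} (x : Fin n → V) :
    ℕ → Fin n → EuclideanSpace ℝ (Fin T.dim)
  | 0, i => T.combine (T.embed (x i)) (T.pos i)
  | k + 1, i =>
      T.act k (activation T x k i) fun h =>
        ∑ j, softmax (fun j' => T.att k h (activation T x k i) (activation T x k j')) j •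
          activation T x k j

/-- The predicted distribution: the softmax of the logits read out from the activation of the
last layer at the last input position. -/
def output [Fintype V] (T : SoftTransformer V) {m : ℕ} (x : Fin (m + 1) → V) : V → ℝ :=
  softmax (T.readout (T.activation x T.layers (Fin.last m)))

/-- Prediction of the symbol after the prefix `x`. The symbols are those of `Option α`, where
`none` is the end-of-sequence symbol; the transformer reads the prefix followed by an
end-of-sequence symbol and predicts at the position of the latter. -/
def predict {α : Type} [Fintype α] (T : SoftTransformer (Option α)) {n : ℕ} (x : Fin n → α) :
    Option α → ℝ :=
  T.output (Fin.snoc (α := fun _ => Option α) (fun i => some (x i)) none)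

/-- Prediction of the symbol after the nonempty prefix `x`, where the transformer reads the prefix
only and predicts at the position of its last symbol. -/
def predictBare {α : Type} [Fintype α] (T : SoftTransformer (Option α)) {m : ℕ}
    (x : Fin (m + 1) → α) : Option α → ℝ :=
  T.output fun i => some (x i)

end SoftTransformer

/-! ### Next-symbol prediction for a distribution on words

`P w` is the probability of the word `w`. All quantities below are conditional probabilities, and
so also make sense when the total mass of `P` is less than one. -/

section Prediction

variable {α : Type}

/-- The probability that a word starts with `x`. -/
def prefixMass (P : List α → ℝ≥0∞) (x : List α) : ℝ≥0∞ := ∑' w : List α, P (x ++ w)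

/-- The probability that the symbol after the prefix `x` is `s`, given that the word starts
with `x`; `s = none` means that the word ends after `x`. -/
def nextProb (P : List α → ℝ≥0∞) (x : List α) : Option α → ℝ
  | some a => (prefixMass P (x ++ [a]) / prefixMass P x).toReal
  | none => (P x / prefixMass P x).toReal

variable [Fintype α]

/-- The probability that the prefix of length `n` is `x`, given that the word has length at
least `n`. -/
def prefixProb (P : List α → ℝ≥0∞) (n : ℕ) (x : Fin n → α) : ℝ :=
  (prefixMass P (List.ofFn x) / ∑ x' : Fin n → α, prefixMass P (List.ofFn x')).toReal

/-- The expected cross-entropy (in nats) of the predictions `q` for the symbol that follows a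
random prefix of length `n`. -/
def crossEntropy (P : List α → ℝ≥0∞) (n : ℕ) (q : (Fin n → α) → Option α → ℝ) : ℝ :=
  ∑ x : Fin n → α, prefixProb P n x *
    ∑ s : Option α, nextProb P (List.ofFn x) s * (-Real.log (q x s))

/-- The optimal cross-entropy, that of the true conditional distribution of the next symbol. -/
def optimalCrossEntropy (P : List α → ℝ≥0∞) (n : ℕ) : ℝ :=
  crossEntropy P n fun x => nextProb P (List.ofFn x)

/-- The unigram distribution: the distribution of the symbol that follows a random prefix of
length `n`, without knowledge of this prefix. -/
def unigram (P : List α → ℝ≥0∞) (n : ℕ) (s : Option α) : ℝ :=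
  ∑ x : Fin n → α, prefixProb P n x * nextProb P (List.ofFn x) s

/-- The unigram chance level: the cross-entropy of the best prediction that does not depend on the
prefix, which predicts the unigram distribution. -/
def chanceLevel (P : List α → ℝ≥0∞) (n : ℕ) : ℝ :=
  crossEntropy P n fun _ => unigram P n

/-- The cross-entropy which the predictions `q` would have if the symbol to be predicted were drawn
from the unigram distribution independently of the prefix. -/
def chanceCrossEntropy (P : List α → ℝ≥0∞) (n : ℕ) (q : (Fin n → α) → Option α → ℝ) : ℝ :=
  ∑ x : Fin n → α, prefixProb P n x * ∑ s : Option α, unigram P n s * (-Real.log (q x s))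

end Prediction

/-! ### The distribution for Parity -/

/-- The probability that the two-state automaton, started in the state `odd` (whether the number
of ones emitted so far is odd), emits the bits `w` and then terminates. In the even state it
terminates with probability `p` and otherwise emits a fair bit; in the odd state it emits a fair
bit. -/
def parityRun (p : ℝ) : (odd : Bool) → (w : List Bool) → ℝ
  | false, [] => p
  | true, [] => 0
  | false, b :: w => (1 - p) / 2 * parityRun p b w
  | true, b :: w => 1 / 2 * parityRun p (!b) w

/-- The probability of a bit string; `true` is the bit 1. -/
def parityDist (p : ℝ) (w : List Bool) : ℝ≥0∞ := ENNReal.ofReal (parityRun p false w)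

/-! ### The distribution for 2Dyck -/

/-- The two types of brackets. -/
inductive BracketType
  | round
  | square
deriving DecidableEq

instance : Fintype BracketType where
  elems := {BracketType.round, BracketType.square}
  complete := by intro t; cases t <;> simp

/-- The four brackets. -/
inductive Bracket
  | opening (t : BracketType)
  | closing (t : BracketType)
deriving DecidableEq

instance : Fintype Bracket where
  elems := Finset.univ.image Bracket.opening ∪ Finset.univ.image Bracket.closing
  complete := by intro b; cases b <;> simp

/-- Derivation trees of the grammar `S → (S)S`, `S → [S]S`, `S → ε`. -/
inductive Derivation
  | eps
  | node (t : BracketType) (l r : Derivation)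

namespace Derivation

/-- The word derived. -/
def yield : Derivation → List Bracket
  | eps => []
  | node t l r => Bracket.opening t :: (yield l ++ Bracket.closing t :: yield r)

/-- The product of the probabilities of the rules used. -/
def prob (p : ℝ) : Derivation → ℝ
  | eps => 1 - p
  | node _ l r => p / 2 * prob p l * prob p r

end Derivation

/-- The probability of a word under the probabilistic context-free grammar. -/
def dyckDist (p : ℝ) (w : List Bracket) : ℝ≥0∞ :=
  ∑' d : {d : Derivation // d.yield = w}, ENNReal.ofReal (d.1.prob p)

end SoftAttention

end

noncomputable section

namespace SoftAttention

/-! ### Stability of soft attention -/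

/-! Soft attention cannot single out one position of a long input. All activations of a fixed layer
lie in one ball, whatever the input length, because softmax averages never leave a ball. Scores are
therefore bounded, every attention weight is of order 1/n, and changing one symbol moves each head
at any other position by o(1). Uniform continuity on balls carries this through the fixed number of
layers (`exists_activation_stable`), so a prediction hardly reacts to one changed symbol, unless it
is the symbol at the predicting position.

For Parity, flipping the last bit of a prefix preserves its probability and flips the state of the
automaton. Deviations of the next-symbol distribution from its mean are thus opposite within such a
pair, while the log predictions nearly agree, so the deviations cancel in the cross-entropy
(`abs_crossEntropy_sub_chanceCrossEntropy_le`). Gibbs' inequality compares what is left with the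
chance level, and a constant prediction attains it.

For 2Dyck, extend a prefix by an opening bracket of type t and a pair `()`. The closing bracket of
type t then follows with probability at least a constant, and the one of the other type never does.
The two choices of t differ in one symbol, which is not the last, so the predictions nearly agree
and one of them must be bad. Inserting a matching pair into a derived word costs only a constant
factor (`exists_insert_pair`), so prefixes of this shape have probability bounded below. A Hellinger
bound on relative entropy (`sum_sq_sqrt_sub_sqrt_le`) turns this into a constant excess. -/

theorem exists_norm_le_of_continuous {E F : Type*} [NormedAddCommGroup E] [ProperSpace E]
    [NormedAddCommGroup F] {f : E → F} (hf : Continuous f) (R : ℝ) :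
    ∃ B : ℝ, 0 ≤ B ∧ ∀ a, ‖a‖ ≤ R → ‖f a‖ ≤ B := by
  obtain ⟨B, hB⟩ := (isCompact_closedBall (0 : E) R).exists_bound_of_continuousOn hf.continuousOn
  exact ⟨max B 0, le_max_right _ _, fun a ha => (hB a (by simpa using ha)).trans (le_max_left _ _)⟩

theorem exists_modulus_of_continuous {E F : Type*} [NormedAddCommGroup E] [ProperSpace E]
    [NormedAddCommGroup F] {f : E → F} (hf : Continuous f) (R : ℝ) {ε : ℝ} (hε : 0 < ε) :
    ∃ δ : ℝ, 0 < δ ∧ ∀ a b, ‖a‖ ≤ R → ‖b‖ ≤ R → ‖a - b‖ ≤ δ → ‖f a - f b‖ ≤ ε := by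
  have h := (isCompact_closedBall (0 : E) R).uniformContinuousOn_of_continuous hf.continuousOn
  obtain ⟨δ, hδ, h⟩ := Metric.uniformContinuousOn_iff.1 h ε hε
  refine ⟨δ / 2, by positivity, fun a b ha hb hab => ?_⟩
  rw [← dist_eq_norm]
  refine (h a (by simpa using ha) b (by simpa using hb) ?_).le
  rw [dist_eq_norm]
  linarith

theorem softmax_pos {ι : Type} [Fintype ι] (a : ι → ℝ) (j : ι) : 0 < softmax a j :=
  div_pos (Real.exp_pos _)
    (Finset.sum_pos (fun _ _ => Real.exp_pos _) ⟨j, Finset.mem_univ j⟩)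

theorem sum_softmax {ι : Type} [Fintype ι] [Nonempty ι] (a : ι → ℝ) : ∑ j, softmax a j = 1 := by
  simp only [softmax, ← Finset.sum_div]
  exact div_self (Finset.sum_pos (fun _ _ => Real.exp_pos _) Finset.univ_nonempty).ne'

theorem continuous_softmax {ι : Type} [Fintype ι] (j : ι) :
    Continuous fun a : ι → ℝ => softmax a j := by
  unfold softmax
  refine Continuous.div (by fun_prop) (by fun_prop) fun a => ?_
  exact (Finset.sum_pos (fun _ _ => Real.exp_pos _) ⟨j, Finset.mem_univ j⟩).ne'

theorem norm_sum_softmax_smul_le {ι E : Type} [Fintype ι] [Nonempty ι] [NormedAddCommGroup E]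
    [NormedSpace ℝ E] (a : ι → ℝ) {y : ι → E} {R : ℝ} (hy : ∀ j, ‖y j‖ ≤ R) :
    ‖∑ j, softmax a j • y j‖ ≤ R := by
  calc ‖∑ j, softmax a j • y j‖ ≤ ∑ j, softmax a j * R := by
        refine norm_sum_le_of_le _ fun j _ => ?_
        rw [norm_smul, Real.norm_of_nonneg (softmax_pos a j).le]
        exact mul_le_mul_of_nonneg_left (hy j) (softmax_pos a j).le
    _ = R := by rw [← Finset.sum_mul, sum_softmax, one_mul]

/-- As a quotient, a head can be compared through numerator and denominator separately. -/
theorem sum_softmax_smul_eq {ι E : Type} [Fintype ι] [NormedAddCommGroup E]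
    [NormedSpace ℝ E] (a : ι → ℝ) (y : ι → E) :
    ∑ j, softmax a j • y j = (∑ j, Real.exp (a j))⁻¹ • ∑ j, Real.exp (a j) • y j := by
  rw [Finset.smul_sum]
  refine Finset.sum_congr rfl fun j _ => ?_
  rw [smul_smul, softmax, div_eq_inv_mul]

/-- A sum of terms that change little, except for one bounded term, changes little. -/
theorem norm_sum_sub_sum_le {n : ℕ} {E : Type} [NormedAddCommGroup E] {f g : Fin n → E}
    {η B : ℝ} (hη : 0 ≤ η) (j₀ : Fin n) (h : ∀ j, j ≠ j₀ → ‖f j - g j‖ ≤ η)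
    (hf : ‖f j₀‖ ≤ B) (hg : ‖g j₀‖ ≤ B) :
    ‖∑ j, f j - ∑ j, g j‖ ≤ n * η + 2 * B := by
  have hB : 0 ≤ B := (norm_nonneg _).trans hf
  rw [← Finset.sum_sub_distrib]
  calc ‖∑ j, (f j - g j)‖ ≤ ∑ j, (η + if j = j₀ then 2 * B else 0) := by
        refine norm_sum_le_of_le _ fun j _ => ?_
        split_ifs with hj
        · subst hj
          have := norm_sub_le (f j) (g j)
          linarith
        · simpa using h j hj
    _ = n * η + 2 * B := by
        rw [Finset.sum_add_distrib]
        simp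

/-- The second quotient is bounded as a whole, so only `d` needs a lower bound later. -/
theorem norm_inv_smul_sub_inv_smul_le {E : Type} [NormedAddCommGroup E] [NormedSpace ℝ E]
    {d d' R : ℝ} {v v' : E} (hd : 0 < d) (hd' : 0 < d') (hv' : ‖d'⁻¹ • v'‖ ≤ R) :
    ‖d⁻¹ • v - d'⁻¹ • v'‖ ≤ (‖v - v'‖ + R * ‖d - d'‖) / d := by
  have key : d⁻¹ • v - d'⁻¹ • v' = d⁻¹ • ((v - v') - (d - d') • (d'⁻¹ • v')) := by
    have h1 : v' = d' • (d'⁻¹ • v') := by rw [smul_smul, mul_inv_cancel₀ hd'.ne', one_smul]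
    set u := d'⁻¹ • v'
    rw [h1]
    have h2 : u = d⁻¹ • (d • u) := by rw [smul_smul, inv_mul_cancel₀ hd.ne', one_smul]
    conv_lhs => rw [h2]
    rw [← smul_sub]
    congr 1
    module
  rw [key, norm_smul, norm_inv, Real.norm_of_nonneg hd.le, div_eq_inv_mul]
  gcongr
  refine (norm_sub_le _ _).trans ?_
  rw [norm_smul, mul_comm R]
  gcongr

/-- Stability of one attention head. -/
theorem exists_attention_stable {E : Type} [NormedAddCommGroup E] [NormedSpace ℝ E]
    [ProperSpace E] {att : E → E → ℝ} (hatt : Continuous fun z : E × E => att z.1 z.2)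
    (R : ℝ) {ε : ℝ} (hε : 0 < ε) :
    ∃ δ : ℝ, 0 < δ ∧ ∃ N : ℕ, ∀ n ≥ N, ∀ (y y' : Fin n → E) (j₀ : Fin n),
      (∀ j, ‖y j‖ ≤ R) → (∀ j, ‖y' j‖ ≤ R) → (∀ j, j ≠ j₀ → ‖y j - y' j‖ ≤ δ) →
      ∀ i, i ≠ j₀ →
        ‖∑ j, softmax (fun j' => att (y i) (y j')) j • y j -
          ∑ j, softmax (fun j' => att (y' i) (y' j')) j • y' j‖ ≤ ε := by
  wlog hR : 0 < R generalizing R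
  · obtain ⟨δ, hδ, N, h⟩ := this 1 one_pos
    refine ⟨δ, hδ, N, fun n hn y y' j₀ hy hy' => h n hn y y' j₀ (fun j => ?_) fun j => ?_⟩
    · linarith [hy j]
    · linarith [hy' j]
  have hexp : Continuous fun z : E × E => Real.exp (att z.1 z.2) := hatt.rexp
  have hexpsmul : Continuous fun z : E × E => Real.exp (att z.1 z.2) • z.2 :=
    hexp.smul continuous_snd
  obtain ⟨A, hA0, hA⟩ := exists_norm_le_of_continuous hatt R
  obtain ⟨B, hB0, hB⟩ := exists_norm_le_of_continuous hexp R
  obtain ⟨C, hC0, hC⟩ := exists_norm_le_of_continuous hexpsmul R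
  set a : ℝ := Real.exp (-A)
  have ha : 0 < a := Real.exp_pos _
  -- Chosen so that `η * (1 + R) = ε * a / 2`: the unexceptional terms use half of the error budget.
  set η : ℝ := ε * a / (2 * (1 + R))
  have hη : 0 < η := by positivity
  obtain ⟨δ₁, hδ₁, h₁⟩ := exists_modulus_of_continuous hexp R hη
  obtain ⟨δ₂, hδ₂, h₂⟩ := exists_modulus_of_continuous hexpsmul R hη
  -- For n beyond this `N`, the term at `j₀`, of size at most `2 * (C + R * B)`, fits into the other
  -- half.
  obtain ⟨N, hN⟩ := exists_nat_ge (4 * (C + R * B) / (ε * a))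
  refine ⟨min δ₁ δ₂, by positivity, N, fun n hn y y' j₀ hy hy' hyy i hi => ?_⟩
  have hn0 : 0 < n := j₀.pos
  have : Nonempty (Fin n) := ⟨j₀⟩
  have hp : ∀ {z w : E}, ‖z‖ ≤ R → ‖w‖ ≤ R → ‖((z, w) : E × E)‖ ≤ R := fun hz hw => by
    rw [Prod.norm_def]; exact max_le hz hw
  -- Scores are at least `-A`, so the denominator grows linearly in n and outweighs any single term.
  have hd : n * a ≤ ∑ j, Real.exp (att (y i) (y j)) := by
    have : ∀ j ∈ Finset.univ, a ≤ Real.exp (att (y i) (y j)) := fun j _ =>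
      Real.exp_le_exp.2 (neg_le_of_abs_le (hA (y i, y j) (hp (hy i) (hy j))))
    simpa using Finset.card_nsmul_le_sum Finset.univ _ a this
  have hna : 0 < n * a := by positivity
  have hd0 : 0 < ∑ j, Real.exp (att (y i) (y j)) := hna.trans_le hd
  have hd0' : 0 < ∑ j, Real.exp (att (y' i) (y' j)) :=
    Finset.sum_pos (fun _ _ => Real.exp_pos _) Finset.univ_nonempty
  have hv' := norm_sum_softmax_smul_le (fun j' => att (y' i) (y' j')) hy'
  rw [sum_softmax_smul_eq] at hv'
  rw [sum_softmax_smul_eq, sum_softmax_smul_eq]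
  have hclose : ∀ j, j ≠ j₀ → ‖((y i, y j) : E × E) - (y' i, y' j)‖ ≤ min δ₁ δ₂ := fun j hj => by
    rw [Prod.mk_sub_mk, Prod.norm_def]; exact max_le (hyy i hi) (hyy j hj)
  have e₁ := norm_sum_sub_sum_le (f := fun j => Real.exp (att (y i) (y j)))
    (g := fun j => Real.exp (att (y' i) (y' j))) hη.le j₀
    (fun j hj => h₁ (y i, y j) (y' i, y' j) (hp (hy i) (hy j)) (hp (hy' i) (hy' j))
      ((hclose j hj).trans (min_le_left _ _)))
    (hB (y i, y j₀) (hp (hy i) (hy j₀))) (hB (y' i, y' j₀) (hp (hy' i) (hy' j₀)))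
  have e₂ := norm_sum_sub_sum_le (f := fun j => Real.exp (att (y i) (y j)) • y j)
    (g := fun j => Real.exp (att (y' i) (y' j)) • y' j) hη.le j₀
    (fun j hj => h₂ (y i, y j) (y' i, y' j) (hp (hy i) (hy j)) (hp (hy' i) (hy' j))
      ((hclose j hj).trans (min_le_right _ _)))
    (hC (y i, y j₀) (hp (hy i) (hy j₀))) (hC (y' i, y' j₀) (hp (hy' i) (hy' j₀)))
  refine (norm_inv_smul_sub_inv_smul_le hd0 hd0' hv').trans ?_
  rw [div_le_iff₀ hd0]
  refine le_trans ?_ (mul_le_mul_of_nonneg_left hd hε.le)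
  have e₃ : R * ‖∑ j, Real.exp (att (y i) (y j)) - ∑ j, Real.exp (att (y' i) (y' j))‖ ≤
      R * (n * η + 2 * B) := mul_le_mul_of_nonneg_left e₁ hR.le
  have hNn : 4 * (C + R * B) ≤ n * (ε * a) := by
    rw [div_le_iff₀ (by positivity)] at hN
    refine hN.trans ?_
    gcongr
  have hη' : η * (1 + R) = ε * a / 2 := by
    simp only [η]
    field_simp
  have : n * η + 2 * C + R * (n * η + 2 * B) = n * (η * (1 + R)) + 2 * (C + R * B) := by ring
  rw [hη'] at this
  linarith

/-! ### Boundedness and stability of activations -/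

namespace SoftTransformer

variable {V : Type} [Finite V]

/-- The bound is uniform in n because each head outputs a convex combination of activations of the
previous layer. -/
theorem exists_norm_activation_le (T : SoftTransformer V) (k : ℕ) :
    ∃ R : ℝ, 0 ≤ R ∧ ∀ (n : ℕ) (x : Fin n → V) (i : Fin n), ‖T.activation x k i‖ ≤ R := by
  induction k with
  | zero =>
    obtain ⟨B, hB⟩ := T.pos_bounded
    obtain ⟨A, hA⟩ := (Set.finite_range fun v => ‖T.embed v‖).bddAbove
    obtain ⟨R, hR0, hR⟩ := exists_norm_le_of_continuous T.combine_cont (max A B)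
    refine ⟨R, hR0, fun n x i => hR (T.embed (x i), T.pos i) ?_⟩
    rw [Prod.norm_def]
    exact max_le_max (hA ⟨x i, rfl⟩) (hB i)
  | succ k ih =>
    obtain ⟨R, hR0, hR⟩ := ih
    obtain ⟨R', hR0', hR'⟩ := exists_norm_le_of_continuous (T.act_cont k) R
    refine ⟨R', hR0', fun n x i => ?_⟩
    have : Nonempty (Fin n) := ⟨i⟩
    refine hR' (T.activation x k i, _) ?_
    rw [Prod.norm_def]
    exact max_le (hR n x i) ((pi_norm_le_iff_of_nonneg hR0).2 fun h =>
      norm_sum_softmax_smul_le _ (hR n x))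

/-- Changing one symbol of a long input hardly changes the activations at the other positions. -/
theorem exists_activation_stable (T : SoftTransformer V) (k : ℕ) {ε : ℝ} (hε : 0 < ε) :
    ∃ N : ℕ, ∀ n ≥ N, ∀ (x x' : Fin n → V) (j₀ : Fin n), (∀ j, j ≠ j₀ → x j = x' j) →
      ∀ i, i ≠ j₀ → ‖T.activation x k i - T.activation x' k i‖ ≤ ε := by
  induction k generalizing ε with
  | zero =>
    refine ⟨0, fun n _ x x' j₀ hx i hi => ?_⟩
    simp only [activation, hx i hi, sub_self, norm_zero]
    exact hε.le
  | succ k ih =>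
    obtain ⟨R, hR0, hR⟩ := T.exists_norm_activation_le k
    obtain ⟨δ, hδ, hact⟩ := exists_modulus_of_continuous (T.act_cont k) R hε
    choose δ' hδ' N' hatt using fun h => exists_attention_stable (T.att_cont k h) R hδ
    obtain ⟨δ'', hδ'', hle⟩ : ∃ δ'' > 0, δ'' ≤ δ ∧ ∀ h, δ'' ≤ δ' h := by
      -- A layer may have no heads; any positive value then serves as the minimum.
      obtain ⟨m, hm, hm'⟩ : ∃ m > 0, ∀ h, m ≤ δ' h := by
        rcases isEmpty_or_nonempty (Fin T.heads) with h | h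
        · exact ⟨1, one_pos, fun h' => h.elim h'⟩
        · obtain ⟨h₀, hh₀⟩ := Finite.exists_min δ'
          exact ⟨δ' h₀, hδ' h₀, hh₀⟩
      exact ⟨min δ m, lt_min hδ hm, min_le_left _ _, fun h => (min_le_right _ _).trans (hm' h)⟩
    obtain ⟨N, hN⟩ := ih hδ''
    refine ⟨max N (Finset.univ.sup N'), fun n hn x x' j₀ hx i hi => ?_⟩
    have : Nonempty (Fin n) := ⟨i⟩
    have hn₁ : N ≤ n := (le_max_left _ _).trans hn
    have hn₂ : ∀ h, N' h ≤ n := fun h =>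
      (Finset.le_sup (f := N') (Finset.mem_univ h)).trans ((le_max_right _ _).trans hn)
    have hyy := hN n hn₁ x x' j₀ hx
    refine hact (T.activation x k i, _) (T.activation x' k i, _) ?_ ?_ ?_
    · rw [Prod.norm_def]
      exact max_le (hR n x i) ((pi_norm_le_iff_of_nonneg hR0).2 fun h =>
        norm_sum_softmax_smul_le _ (hR n x))
    · rw [Prod.norm_def]
      exact max_le (hR n x' i) ((pi_norm_le_iff_of_nonneg hR0).2 fun h =>
        norm_sum_softmax_smul_le _ (hR n x'))
    · rw [Prod.mk_sub_mk, Prod.norm_def]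
      refine max_le ((hyy i hi).trans hle.1) ((pi_norm_le_iff_of_nonneg hδ.le).2 fun h => ?_)
      exact hatt h n (hn₂ h) _ _ j₀ (hR n x) (hR n x')
        (fun j hj => (hyy j hj).trans (hle.2 h)) i hi

theorem exists_comp_activation_stable (T : SoftTransformer V) (k : ℕ)
    {Φ : EuclideanSpace ℝ (Fin T.dim) → ℝ} (hΦ : Continuous Φ) {ε : ℝ} (hε : 0 < ε) :
    ∃ N : ℕ, ∀ n ≥ N, ∀ (x x' : Fin n → V) (j₀ : Fin n), (∀ j, j ≠ j₀ → x j = x' j) →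
      ∀ i, i ≠ j₀ → |Φ (T.activation x k i) - Φ (T.activation x' k i)| ≤ ε := by
  obtain ⟨R, hR0, hR⟩ := T.exists_norm_activation_le k
  obtain ⟨δ, hδ, hmod⟩ := exists_modulus_of_continuous hΦ R hε
  obtain ⟨N, hN⟩ := T.exists_activation_stable k hδ
  exact ⟨N, fun n hn x x' j₀ hx i hi =>
    hmod _ _ (hR n x i) (hR n x' i) (hN n hn x x' j₀ hx i hi)⟩

end SoftTransformer

/-! ### Stability of predictions -/

namespace SoftTransformer

variable {V : Type} [Fintype V]

/-- Used with `g = Real.log` for Parity and `g = id` for 2Dyck; continuity on the positive reals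
suffices since softmax values are positive. -/
theorem exists_output_stable (T : SoftTransformer V) {g : ℝ → ℝ} (hg : ContinuousOn g (Set.Ioi 0))
    {ε : ℝ} (hε : 0 < ε) :
    ∃ N : ℕ, ∀ m ≥ N, ∀ (x x' : Fin (m + 1) → V) (j₀ : Fin (m + 1)), j₀ ≠ Fin.last m →
      (∀ j, j ≠ j₀ → x j = x' j) → ∀ s, |g (T.output x s) - g (T.output x' s)| ≤ ε := by
  have hcont : ∀ s, Continuous fun y => g (softmax (T.readout y) s) := fun s =>
    hg.comp_continuous ((continuous_softmax s).comp T.readout_cont) fun y => softmax_pos _ _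
  choose N hN using fun s => T.exists_comp_activation_stable T.layers (hcont s) hε
  refine ⟨Finset.univ.sup N, fun m hm x x' j₀ hj₀ hx s => ?_⟩
  exact hN s (m + 1) ((Finset.le_sup (f := N) (Finset.mem_univ s)).trans (hm.trans m.le_succ))
    x x' j₀ hx _ hj₀.symm

/-- The predicting position holds the end-of-sequence symbol, so every letter of the prefix, even
the last, may be changed. -/
theorem exists_predict_stable {α : Type} [Fintype α] (T : SoftTransformer (Option α))
    {g : ℝ → ℝ} (hg : ContinuousOn g (Set.Ioi 0)) {ε : ℝ} (hε : 0 < ε) :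
    ∃ N : ℕ, ∀ n ≥ N, ∀ (x x' : Fin n → α) (j₀ : Fin n),
      (∀ j, j ≠ j₀ → x j = x' j) → ∀ s, |g (T.predict x s) - g (T.predict x' s)| ≤ ε := by
  obtain ⟨N, hN⟩ := T.exists_output_stable hg hε
  refine ⟨N, fun n hn x x' j₀ hx s => hN n hn _ _ j₀.castSucc (Fin.castSucc_lt_last j₀).ne ?_ s⟩
  refine Fin.lastCases (by simp) fun j hj => ?_
  have : j ≠ j₀ := fun h => hj (h ▸ rfl)
  simp [hx j this]

theorem predict_pos {α : Type} [Fintype α] (T : SoftTransformer (Option α)) {n : ℕ}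
    (x : Fin n → α) (s : Option α) : 0 < T.predict x s := softmax_pos _ _

theorem sum_predict {α : Type} [Fintype α] (T : SoftTransformer (Option α)) {n : ℕ}
    (x : Fin n → α) : ∑ s, T.predict x s = 1 := sum_softmax _

end SoftTransformer

/-! ### Relative entropy -/

/-- This is `log x ≤ x - 1` at `x = √b / √a`. The linear term `a - b` cancels on summing over two
probability distributions. -/
theorem sq_sqrt_sub_sqrt_add_le_mul_log {a b : ℝ} (ha : 0 ≤ a) (hb : 0 < b) :
    (√a - √b) ^ 2 + (a - b) ≤ a * (-Real.log b) - a * (-Real.log a) := by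
  have h2 := Real.sq_sqrt hb.le
  rcases ha.eq_or_lt with rfl | ha
  · simp [h2]
  have h1 := Real.sq_sqrt ha.le
  have hsa : 0 < √a := Real.sqrt_pos.2 ha
  have hsb : 0 < √b := Real.sqrt_pos.2 hb
  have hlog := Real.log_le_sub_one_of_pos (div_pos hsb hsa)
  rw [Real.log_div hsb.ne' hsa.ne', Real.log_sqrt hb.le, Real.log_sqrt ha.le] at hlog
  have h3 : a * (√b / √a) = √a * √b := by
    nth_rewrite 1 [← h1]
    field_simp
  have h4 := mul_le_mul_of_nonneg_left hlog ha.le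
  rw [mul_sub _ (√b / √a), h3] at h4
  nlinarith

theorem sum_sq_sqrt_sub_sqrt_le {ι : Type} [Fintype ι] {f q : ι → ℝ} (hf : ∀ s, 0 ≤ f s)
    (hf1 : ∑ s, f s = 1) (hq : ∀ s, 0 < q s) (hq1 : ∑ s, q s = 1) :
    ∑ s, (√(f s) - √(q s)) ^ 2 ≤
      ∑ s, f s * (-Real.log (q s)) - ∑ s, f s * (-Real.log (f s)) := by
  have h := Finset.sum_le_sum fun s (_ : s ∈ Finset.univ) =>
    sq_sqrt_sub_sqrt_add_le_mul_log (hf s) (hq s)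
  rw [Finset.sum_add_distrib, Finset.sum_sub_distrib, Finset.sum_sub_distrib, hf1, hq1] at h
  linarith

theorem entropy_le {ι : Type} [Fintype ι] {f q : ι → ℝ} (hf : ∀ s, 0 ≤ f s)
    (hf1 : ∑ s, f s = 1) (hq : ∀ s, 0 < q s) (hq1 : ∑ s, q s = 1) :
    ∑ s, f s * (-Real.log (f s)) ≤ ∑ s, f s * (-Real.log (q s)) := by
  have h1 := sum_sq_sqrt_sub_sqrt_le hf hf1 hq hq1
  have h2 : 0 ≤ ∑ s, (√(f s) - √(q s)) ^ 2 := Finset.sum_nonneg fun s _ => sq_nonneg _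
  linarith

/-! ### Masses of prefixes -/

section Prefix

variable {α : Type}

theorem tsum_list_eq [Fintype α] (F : List α → ℝ≥0∞) :
    ∑' w, F w = F [] + ∑ a, ∑' w, F (a :: w) := by
  let e : Unit ⊕ α × List α ≃ List α :=
    { toFun := Sum.elim (fun _ => []) fun z => z.1 :: z.2
      invFun := fun w => match w with
        | [] => .inl ()
        | a :: w => .inr (a, w)
      left_inv := by rintro (_ | ⟨a, w⟩) <;> rfl
      right_inv := by rintro (_ | ⟨a, w⟩) <;> rfl }
  rw [← e.tsum_eq, Summable.tsum_sum ENNReal.summable ENNReal.summable, tsum_fintype,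
    ← tsum_fintype (L := .unconditional _) (fun a => ∑' w, F (a :: w)), ← ENNReal.tsum_prod]
  simp [e]

/-- A series is bounded by a common bound of the sums of its truncations. -/
theorem tsum_le_of_truncations {β : Type} {f : β → ℝ≥0∞} (F : ℕ → β → ℝ≥0∞) (size : β → ℕ)
    {c : ℝ≥0∞} (hF : ∀ N b, size b < N → F N b = f b) (hc : ∀ N, ∑' b, F N b ≤ c) :
    ∑' b, f b ≤ c := by
  rw [ENNReal.tsum_eq_iSup_sum]
  refine iSup_le fun S => ?_
  calc ∑ b ∈ S, f b = ∑ b ∈ S, F (S.sup size + 1) b :=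
        Finset.sum_congr rfl fun b hb => (hF _ b (Nat.lt_succ_of_le (Finset.le_sup hb))).symm
    _ ≤ ∑' b, F (S.sup size + 1) b := ENNReal.sum_le_tsum S
    _ ≤ c := hc _

theorem ofFn_snoc {n : ℕ} (y : Fin n → α) (a : α) :
    List.ofFn (Fin.snoc (α := fun _ => α) y a) = List.ofFn y ++ [a] := by
  rw [List.ofFn_succ']
  simp

theorem nextProb_nonneg (P : List α → ℝ≥0∞) (x : List α) (s : Option α) : 0 ≤ nextProb P x s := by
  cases s <;> exact ENNReal.toReal_nonneg

variable [Fintype α]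

theorem sum_snoc {M : Type} [AddCommMonoid M] {n : ℕ} (g : (Fin (n + 1) → α) → M) :
    ∑ x, g x = ∑ y : Fin n → α, ∑ a, g (Fin.snoc (α := fun _ => α) y a) := by
  rw [← (Fin.snocEquiv fun _ : Fin (n + 1) => α).sum_comp, Fintype.sum_prod_type,
    Finset.sum_comm]
  rfl

variable (P : List α → ℝ≥0∞)

/-- The probability that a word has length at least `n`. -/
def levelMass (n : ℕ) : ℝ≥0∞ := ∑ x : Fin n → α, prefixMass P (List.ofFn x)

theorem prefixMass_eq_add (x : List α) :
    prefixMass P x = P x + ∑ a, prefixMass P (x ++ [a]) := by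
  rw [prefixMass, tsum_list_eq]
  simp [prefixMass]

theorem prefixMass_append_singleton_le (x : List α) (a : α) :
    prefixMass P (x ++ [a]) ≤ prefixMass P x := by
  rw [prefixMass_eq_add P x]
  exact (Finset.single_le_sum_of_canonicallyOrdered (f := fun a => prefixMass P (x ++ [a]))
    (Finset.mem_univ a)).trans le_add_self

theorem levelMass_succ_le (n : ℕ) : levelMass P (n + 1) ≤ levelMass P n := by
  rw [levelMass, sum_snoc]
  refine Finset.sum_le_sum fun y _ => ?_
  simp only [ofFn_snoc]
  rw [prefixMass_eq_add P (List.ofFn y)]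
  exact le_add_self

theorem levelMass_zero : levelMass P 0 = ∑' w, P w := by
  simp [levelMass, prefixMass]

theorem levelMass_ne_top (h : ∑' w, P w ≠ ⊤) (n : ℕ) : levelMass P n ≠ ⊤ := by
  have := antitone_nat_of_succ_le (levelMass_succ_le P) n.zero_le
  rw [levelMass_zero] at this
  exact ne_top_of_le_ne_top h this

variable {P}

theorem prefixMass_ofFn_le {n : ℕ} (x : Fin n → α) :
    prefixMass P (List.ofFn x) ≤ levelMass P n :=
  Finset.single_le_sum_of_canonicallyOrdered (f := fun x : Fin n → α => prefixMass P (List.ofFn x))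
    (Finset.mem_univ x)

theorem sum_prefixProb {n : ℕ} (h0 : levelMass P n ≠ 0) (h : levelMass P n ≠ ⊤) :
    ∑ x, prefixProb P n x = 1 := by
  unfold prefixProb
  rw [← ENNReal.toReal_sum]
  · simp only [div_eq_mul_inv]
    rw [← Finset.sum_mul]
    change (levelMass P n * (levelMass P n)⁻¹).toReal = 1
    rw [ENNReal.mul_inv_cancel h0 h, ENNReal.toReal_one]
  · intro x _
    exact ENNReal.div_ne_top (ne_top_of_le_ne_top h (prefixMass_ofFn_le x)) h0

theorem prefixProb_nonneg {n : ℕ} (x : Fin n → α) : 0 ≤ prefixProb P n x := ENNReal.toReal_nonneg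

theorem sum_nextProb {x : List α} (h0 : prefixMass P x ≠ 0) (h : prefixMass P x ≠ ⊤) :
    ∑ s, nextProb P x s = 1 := by
  rw [Fintype.sum_option]
  have hP : P x ≤ prefixMass P x := by
    rw [prefixMass_eq_add P x]
    exact le_self_add
  simp only [nextProb]
  rw [← ENNReal.toReal_sum, ← ENNReal.toReal_add]
  · simp only [div_eq_mul_inv]
    rw [← Finset.sum_mul, ← add_mul, ← prefixMass_eq_add, ENNReal.mul_inv_cancel h0 h,
      ENNReal.toReal_one]
  · exact ENNReal.div_ne_top (ne_top_of_le_ne_top h hP) h0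
  · refine ENNReal.sum_ne_top.2 fun a _ => ?_
    exact ENNReal.div_ne_top (ne_top_of_le_ne_top h (prefixMass_append_singleton_le P x a)) h0
  · intro a _
    exact ENNReal.div_ne_top (ne_top_of_le_ne_top h (prefixMass_append_singleton_le P x a)) h0

theorem chanceLevel_eq (P : List α → ℝ≥0∞) (n : ℕ) :
    chanceLevel P n = ∑ s, unigram P n s * (-Real.log (unigram P n s)) := by
  simp only [chanceLevel, crossEntropy]
  conv_rhs => enter [2, s, 1]; rw [unigram]
  simp only [Finset.mul_sum, Finset.sum_mul]
  rw [Finset.sum_comm]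
  simp only [mul_assoc]

theorem crossEntropy_const (P : List α → ℝ≥0∞) (n : ℕ) (q : Option α → ℝ) :
    crossEntropy P n (fun _ => q) = ∑ s, unigram P n s * (-Real.log (q s)) := by
  simp only [unigram, crossEntropy, Finset.mul_sum, Finset.sum_mul]
  rw [Finset.sum_comm]
  simp only [mul_assoc]

end Prefix

/-! ### Parity -/

section Parity

variable {p : ℝ}

/-- The distribution of the next symbol of the Parity automaton in a given state. -/
def parityNext (p : ℝ) (odd : Bool) : Option Bool → ℝ
  | none => if odd then 0 else p
  | some _ => if odd then 1 / 2 else (1 - p) / 2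

theorem parityRun_nil (odd : Bool) : parityRun p odd [] = parityNext p odd none := by
  cases odd <;> rfl

theorem parityRun_cons (odd b : Bool) (w : List Bool) :
    parityRun p odd (b :: w) = parityNext p odd (some b) * parityRun p (odd ^^ b) w := by
  cases odd <;> simp [parityRun, parityNext]

theorem parityNext_nonneg (hp0 : 0 < p) (hp1 : p < 1) (odd : Bool) (s : Option Bool) :
    0 ≤ parityNext p odd s := by
  cases odd <;> cases s <;> simp [parityNext] <;> linarith

theorem parityNext_some_pos (hp1 : p < 1) (odd b : Bool) : 0 < parityNext p odd (some b) := by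
  cases odd <;> simp [parityNext]
  linarith

theorem sum_parityNext (odd : Bool) : ∑ s, parityNext p odd s = 1 := by
  cases odd <;> simp [Fintype.sum_option, parityNext] ; ring

theorem parityNext_le_one (hp0 : 0 < p) (hp1 : p < 1) (odd : Bool) (s : Option Bool) :
    parityNext p odd s ≤ 1 := by
  rw [← sum_parityNext (p := p) odd]
  exact Finset.single_le_sum (f := parityNext p odd)
    (fun s _ => parityNext_nonneg hp0 hp1 odd s) (Finset.mem_univ s)

/-- The probability that the Parity automaton, started in the given state, emits the word `x`
first and terminates eventually. -/
def parityMass (p : ℝ) (odd : Bool) (x : List Bool) : ℝ≥0∞ :=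
  ∑' w, ENNReal.ofReal (parityRun p odd (x ++ w))

theorem ofReal_parityRun_cons (hp0 : 0 < p) (hp1 : p < 1) (odd b : Bool) (w : List Bool) :
    ENNReal.ofReal (parityRun p odd (b :: w)) =
      ENNReal.ofReal (parityNext p odd (some b)) * ENNReal.ofReal (parityRun p (odd ^^ b) w) := by
  rw [parityRun_cons, ENNReal.ofReal_mul (parityNext_nonneg hp0 hp1 _ _)]

theorem parityMass_cons (hp0 : 0 < p) (hp1 : p < 1) (odd b : Bool) (x : List Bool) :
    parityMass p odd (b :: x) =
      ENNReal.ofReal (parityNext p odd (some b)) * parityMass p (odd ^^ b) x := by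
  simp only [parityMass, List.cons_append, ofReal_parityRun_cons hp0 hp1, ENNReal.tsum_mul_left]

theorem parityMass_nil (hp0 : 0 < p) (hp1 : p < 1) (odd : Bool) :
    parityMass p odd [] = ENNReal.ofReal (parityNext p odd none) +
      ∑ b, ENNReal.ofReal (parityNext p odd (some b)) * parityMass p (odd ^^ b) [] := by
  simp only [← parityMass_cons hp0 hp1]
  rw [parityMass, tsum_list_eq]
  simp [parityMass, parityRun_nil]

/-- Restricting to words of length below N allows induction on N. Finiteness is needed before the
mass equations can be solved in the reals. -/
theorem parityMass_nil_le_one (hp0 : 0 < p) (hp1 : p < 1) (odd : Bool) :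
    parityMass p odd [] ≤ 1 := by
  refine tsum_le_of_truncations
    (fun N w => if w.length < N then ENNReal.ofReal (parityRun p odd w) else 0) List.length
    (fun N w h => by simp [h]) fun N => ?_
  induction N generalizing odd with
  | zero => simp
  | succ N ih =>
    rw [tsum_list_eq]
    calc _ ≤ ENNReal.ofReal (parityNext p odd none) +
          ∑ b, ENNReal.ofReal (parityNext p odd (some b)) * 1 := by
          refine add_le_add (by simp [parityRun_nil]) (Finset.sum_le_sum fun b _ => ?_)
          refine le_trans (le_of_eq ?_) (mul_le_mul_right (ih (odd ^^ b)) _)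
          rw [← ENNReal.tsum_mul_left]
          refine tsum_congr fun w => ?_
          simp [ofReal_parityRun_cons hp0 hp1]
      _ = ENNReal.ofReal (∑ s, parityNext p odd s) := by
          rw [ENNReal.ofReal_sum_of_nonneg fun s _ => parityNext_nonneg hp0 hp1 odd s,
            Fintype.sum_option]
          simp
      _ ≤ 1 := by rw [sum_parityNext, ENNReal.ofReal_one]

/-- The masses of the two states satisfy a linear system: the odd equation makes them equal, and the
even one then gives `p * (mass - 1) = 0`. The automaton thus terminates almost surely, so
conditioning on a prefix returns its transition probabilities. -/
theorem parityMass_nil_eq_one (hp0 : 0 < p) (hp1 : p < 1) (odd : Bool) :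
    parityMass p odd [] = 1 := by
  have hfin : ∀ o, parityMass p o [] ≠ ⊤ := fun o =>
    ne_top_of_le_ne_top ENNReal.one_ne_top (parityMass_nil_le_one hp0 hp1 o)
  have key : ∀ o, (parityMass p o []).toReal = parityNext p o none +
      ∑ b, parityNext p o (some b) * (parityMass p (o ^^ b) []).toReal := fun o => by
    have hb : ∀ b, ENNReal.ofReal (parityNext p o (some b)) * parityMass p (o ^^ b) [] ≠ ⊤ :=
      fun b => ENNReal.mul_ne_top ENNReal.ofReal_ne_top (hfin _)
    rw [parityMass_nil hp0 hp1, ENNReal.toReal_add ENNReal.ofReal_ne_top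
      (ENNReal.sum_ne_top.2 fun b _ => hb b), ENNReal.toReal_sum fun b _ => hb b]
    simp only [ENNReal.toReal_mul, ENNReal.toReal_ofReal (parityNext_nonneg hp0 hp1 _ _)]
  have h0 := key false
  have h1 := key true
  simp [parityNext] at h0 h1
  have h2 : (parityMass p false []).toReal = (parityMass p true []).toReal := by linarith
  have h3 : (parityMass p true []).toReal = 1 := by
    rw [h2] at h0
    have : p * ((parityMass p true []).toReal - 1) = 0 := by linear_combination h0
    rcases mul_eq_zero.1 this with h | h <;> linarith
  have h4 : ∀ o, (parityMass p o []).toReal = 1 := by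
    rintro (_ | _)
    · rw [h2, h3]
    · exact h3
  rw [← ENNReal.ofReal_toReal (hfin odd), h4, ENNReal.ofReal_one]

theorem parityMass_ne_zero (hp0 : 0 < p) (hp1 : p < 1) (odd : Bool) (x : List Bool) :
    parityMass p odd x ≠ 0 := by
  induction x generalizing odd with
  | nil => simp [parityMass_nil_eq_one hp0 hp1]
  | cons b x ih =>
    rw [parityMass_cons hp0 hp1]
    exact mul_ne_zero (ENNReal.ofReal_pos.2 (parityNext_some_pos hp1 _ _)).ne' (ih _)

theorem parityMass_ne_top (hp0 : 0 < p) (hp1 : p < 1) (odd : Bool) (x : List Bool) :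
    parityMass p odd x ≠ ⊤ := by
  induction x generalizing odd with
  | nil => simp [parityMass_nil_eq_one hp0 hp1]
  | cons b x ih =>
    rw [parityMass_cons hp0 hp1]
    exact ENNReal.mul_ne_top ENNReal.ofReal_ne_top (ih _)

theorem parityMass_append_singleton (hp0 : 0 < p) (hp1 : p < 1) (odd b : Bool) (x : List Bool) :
    parityMass p odd (x ++ [b]) =
      ENNReal.ofReal (parityNext p (x.foldl xor odd) (some b)) * parityMass p odd x := by
  induction x generalizing odd with
  | nil =>
    rw [List.nil_append, parityMass_cons hp0 hp1, parityMass_nil_eq_one hp0 hp1,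
      parityMass_nil_eq_one hp0 hp1]
    rfl
  | cons a x ih =>
    rw [List.cons_append, parityMass_cons hp0 hp1, ih, parityMass_cons hp0 hp1, List.foldl_cons]
    ring

theorem ofReal_parityRun_eq (hp0 : 0 < p) (hp1 : p < 1) (odd : Bool) (x : List Bool) :
    ENNReal.ofReal (parityRun p odd x) =
      ENNReal.ofReal (parityNext p (x.foldl xor odd) none) * parityMass p odd x := by
  induction x generalizing odd with
  | nil => rw [parityRun_nil, parityMass_nil_eq_one hp0 hp1, mul_one, List.foldl_nil]
  | cons a x ih =>
    rw [ofReal_parityRun_cons hp0 hp1, ih, parityMass_cons hp0 hp1, List.foldl_cons]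
    ring

theorem nextProb_parityDist (hp0 : 0 < p) (hp1 : p < 1) (x : List Bool) (s : Option Bool) :
    nextProb (parityDist p) x s = parityNext p (x.foldl xor false) s := by
  have h : ∀ c : ℝ, 0 ≤ c → (ENNReal.ofReal c * parityMass p false x /
      parityMass p false x).toReal = c := fun c hc => by
    rw [ENNReal.mul_div_cancel_right (parityMass_ne_zero hp0 hp1 _ _)
      (parityMass_ne_top hp0 hp1 _ _), ENNReal.toReal_ofReal hc]
  cases s with
  | none =>
    change (ENNReal.ofReal (parityRun p false x) / parityMass p false x).toReal = _
    rw [ofReal_parityRun_eq hp0 hp1, h _ (parityNext_nonneg hp0 hp1 _ _)]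
  | some b =>
    change (parityMass p false (x ++ [b]) / parityMass p false x).toReal = _
    rw [parityMass_append_singleton hp0 hp1, h _ (parityNext_nonneg hp0 hp1 _ _)]

/-- The average of the two distributions of the next symbol. -/
def parityMean (p : ℝ) (s : Option Bool) : ℝ := (parityNext p false s + parityNext p true s) / 2

theorem parityMean_pos (hp0 : 0 < p) (hp1 : p < 1) (s : Option Bool) : 0 < parityMean p s := by
  cases s <;> simp [parityMean, parityNext] <;> linarith

theorem sum_parityMean : ∑ s, parityMean p s = 1 := by
  simp only [parityMean, ← Finset.sum_div, Finset.sum_add_distrib, sum_parityNext]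
  norm_num

theorem parityNext_add_not (odd : Bool) (s : Option Bool) :
    parityNext p odd s + parityNext p (!odd) s = 2 * parityMean p s := by
  cases odd <;> simp only [parityMean, Bool.not_false, Bool.not_true] <;> ring

/-- The prefix probability does not depend on the last bit. -/
theorem prefixProb_parityDist_snoc (hp0 : 0 < p) (hp1 : p < 1) {m : ℕ} (y : Fin m → Bool)
    (b b' : Bool) :
    prefixProb (parityDist p) (m + 1) (Fin.snoc (α := fun _ => Bool) y b) =
      prefixProb (parityDist p) (m + 1) (Fin.snoc (α := fun _ => Bool) y b') := by
  have h : ∀ x b, prefixMass (parityDist p) (x ++ [b]) =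
      ENNReal.ofReal (parityNext p (x.foldl xor false) (some b)) * prefixMass (parityDist p) x :=
    fun x b => parityMass_append_singleton hp0 hp1 false b x
  simp only [prefixProb, ofFn_snoc, h]
  -- In either state both bits are equally likely, and `parityNext` ignores the bit.
  rfl

theorem sum_prefixProb_parityDist (hp0 : 0 < p) (hp1 : p < 1) (n : ℕ) :
    ∑ x, prefixProb (parityDist p) n x = 1 := by
  refine sum_prefixProb ?_ (levelMass_ne_top _ ?_ n)
  · intro h
    rw [levelMass, Finset.sum_eq_zero_iff] at h
    exact parityMass_ne_zero hp0 hp1 false _ (h (fun _ => false) (Finset.mem_univ _))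
  · exact parityMass_ne_top hp0 hp1 false []

/-- Averages over random prefixes, computed by pairing the prefixes that differ in the last bit. -/
theorem sum_prefixProb_parityDist_mul (hp0 : 0 < p) (hp1 : p < 1) {m : ℕ}
    (G : (Fin (m + 1) → Bool) → ℝ) :
    ∑ x, prefixProb (parityDist p) (m + 1) x * G x =
      ∑ y : Fin m → Bool,
        prefixProb (parityDist p) (m + 1) (Fin.snoc (α := fun _ => Bool) y true) *
          (G (Fin.snoc (α := fun _ => Bool) y false) + G (Fin.snoc (α := fun _ => Bool) y true)) := by
  rw [sum_snoc]
  refine Finset.sum_congr rfl fun y _ => ?_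
  rw [Fintype.sum_bool, prefixProb_parityDist_snoc hp0 hp1 y false true]
  ring

theorem nextProb_parityDist_snoc (hp0 : 0 < p) (hp1 : p < 1) {m : ℕ} (y : Fin m → Bool) (b : Bool)
    (s : Option Bool) :
    nextProb (parityDist p) (List.ofFn (Fin.snoc (α := fun _ => Bool) y b)) s =
      parityNext p ((List.ofFn y).foldl xor false ^^ b) s := by
  rw [nextProb_parityDist hp0 hp1, ofFn_snoc, List.foldl_append]
  rfl

theorem two_mul_sum_prefixProb_parityDist (hp0 : 0 < p) (hp1 : p < 1) (m : ℕ) :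
    2 * ∑ y : Fin m → Bool,
      prefixProb (parityDist p) (m + 1) (Fin.snoc (α := fun _ => Bool) y true) = 1 := by
  have h := sum_prefixProb_parityDist_mul hp0 hp1 (m := m) fun _ => 1
  simp only [mul_one, sum_prefixProb_parityDist hp0 hp1, ← Finset.sum_mul] at h
  linarith

theorem unigram_parityDist (hp0 : 0 < p) (hp1 : p < 1) (m : ℕ) :
    unigram (parityDist p) (m + 1) = parityMean p := by
  ext s
  rw [unigram, sum_prefixProb_parityDist_mul hp0 hp1]
  simp only [nextProb_parityDist_snoc hp0 hp1, Bool.xor_false, Bool.xor_true, parityNext_add_not,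
    ← Finset.sum_mul]
  linear_combination parityMean p s * two_mul_sum_prefixProb_parityDist hp0 hp1 m

/-- Paired prefixes have equal weight and opposite deviations from `parityMean`, so each symbol
contributes a deviation of at most 1 times a difference of log predictions. The factor 3 counts the
symbols. -/
theorem abs_crossEntropy_sub_chanceCrossEntropy_le (hp0 : 0 < p) (hp1 : p < 1) {m : ℕ}
    {q : (Fin (m + 1) → Bool) → Option Bool → ℝ} {η : ℝ}
    (hq : ∀ y b b' s, |Real.log (q (Fin.snoc (α := fun _ => Bool) y b) s) -
      Real.log (q (Fin.snoc (α := fun _ => Bool) y b') s)| ≤ η) :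
    |crossEntropy (parityDist p) (m + 1) q - chanceCrossEntropy (parityDist p) (m + 1) q| ≤
      3 * η := by
  have hη : 0 ≤ η := (abs_nonneg _).trans (hq (fun _ => true) true true none)
  rw [crossEntropy, chanceCrossEntropy, ← Finset.sum_sub_distrib]
  simp only [← mul_sub, ← Finset.sum_sub_distrib, ← sub_mul]
  rw [sum_prefixProb_parityDist_mul hp0 hp1]
  simp only [nextProb_parityDist_snoc hp0 hp1, Bool.xor_false, Bool.xor_true, unigram_parityDist hp0 hp1,
    ← Finset.sum_add_distrib]
  refine (Finset.abs_sum_le_sum_abs _ _).trans ?_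
  have hbound : ∀ y : Fin m → Bool,
      |prefixProb (parityDist p) (m + 1) (Fin.snoc (α := fun _ => Bool) y true) *
        ∑ s, ((parityNext p ((List.ofFn y).foldl xor false) s - parityMean p s) *
            (-Real.log (q (Fin.snoc (α := fun _ => Bool) y false) s)) +
          (parityNext p (!(List.ofFn y).foldl xor false) s - parityMean p s) *
            (-Real.log (q (Fin.snoc (α := fun _ => Bool) y true) s)))| ≤
      prefixProb (parityDist p) (m + 1) (Fin.snoc (α := fun _ => Bool) y true) * (3 * η) := by
    intro y
    rw [abs_mul, abs_of_nonneg (prefixProb_nonneg _)]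
    refine mul_le_mul_of_nonneg_left ?_ (prefixProb_nonneg _)
    refine (Finset.abs_sum_le_sum_abs _ _).trans ?_
    refine (Finset.sum_le_card_nsmul _ _ η fun s _ => ?_).trans (le_of_eq (by simp))
    set o := (List.ofFn y).foldl xor false
    have h1 := parityNext_add_not (p := p) o s
    have h2 : parityNext p (!o) s - parityMean p s = -(parityNext p o s - parityMean p s) := by
      linarith
    rw [h2]
    have h3 : (parityNext p o s - parityMean p s) *
          (-Real.log (q (Fin.snoc (α := fun _ => Bool) y false) s)) +
        -(parityNext p o s - parityMean p s) *
          (-Real.log (q (Fin.snoc (α := fun _ => Bool) y true) s)) =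
        (parityNext p o s - parityMean p s) *
          (Real.log (q (Fin.snoc (α := fun _ => Bool) y true) s) -
            Real.log (q (Fin.snoc (α := fun _ => Bool) y false) s)) := by ring
    rw [h3, abs_mul]
    have h4 : |parityNext p o s - parityMean p s| ≤ 1 := by
      have a1 := parityNext_nonneg hp0 hp1 o s
      have a2 := parityNext_nonneg hp0 hp1 (!o) s
      have a3 := parityNext_le_one hp0 hp1 o s
      have a4 := parityNext_le_one hp0 hp1 (!o) s
      rw [abs_le]
      constructor <;> linarith
    calc _ ≤ 1 * η := mul_le_mul h4 (hq _ _ _ _) (abs_nonneg _) zero_le_one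
      _ = η := one_mul η
  refine (Finset.sum_le_sum fun y _ => hbound y).trans ?_
  rw [← Finset.sum_mul]
  -- The pair weights sum to 1/2, which leaves room to spare.
  have := two_mul_sum_prefixProb_parityDist hp0 hp1 m
  nlinarith

/-! ### Parity: transformers against chance -/

theorem tendsto_crossEntropy_sub_chanceCrossEntropy (hp0 : 0 < p) (hp1 : p < 1)
    (T : SoftTransformer (Option Bool)) :
    Tendsto (fun n : ℕ => crossEntropy (parityDist p) n (fun x => T.predict x) -
      chanceCrossEntropy (parityDist p) n (fun x => T.predict x)) atTop (𝓝 0) := by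
  rw [Metric.tendsto_atTop]
  intro ε hε
  obtain ⟨N, hN⟩ := T.exists_predict_stable (g := Real.log)
    (Real.continuousOn_log.mono fun x hx => (ne_of_gt hx : x ≠ 0)) (show 0 < ε / 4 by positivity)
  refine ⟨N + 1, fun n hn => ?_⟩
  obtain ⟨m, rfl⟩ : ∃ m, n = m + 1 := ⟨n - 1, by omega⟩
  rw [Real.dist_eq, sub_zero]
  refine (abs_crossEntropy_sub_chanceCrossEntropy_le hp0 hp1 (η := ε / 4)
    fun y b b' s => hN (m + 1) (by omega) _ _ (Fin.last m) ?_ s).trans_lt (by linarith)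
  refine Fin.lastCases (by simp) fun j _ => ?_
  simp

theorem chanceLevel_le_chanceCrossEntropy (hp0 : 0 < p) (hp1 : p < 1) {m : ℕ}
    {q : (Fin (m + 1) → Bool) → Option Bool → ℝ} (hq : ∀ x s, 0 < q x s)
    (hq1 : ∀ x, ∑ s, q x s = 1) :
    chanceLevel (parityDist p) (m + 1) ≤ chanceCrossEntropy (parityDist p) (m + 1) q := by
  rw [chanceLevel_eq, chanceCrossEntropy, unigram_parityDist hp0 hp1]
  calc ∑ s, parityMean p s * (-Real.log (parityMean p s))
      = ∑ x, prefixProb (parityDist p) (m + 1) x *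
          ∑ s, parityMean p s * (-Real.log (parityMean p s)) := by
        rw [← Finset.sum_mul, sum_prefixProb_parityDist hp0 hp1, one_mul]
    _ ≤ _ := Finset.sum_le_sum fun x _ => mul_le_mul_of_nonneg_left
        (entropy_le (fun s => (parityMean_pos hp0 hp1 s).le) sum_parityMean (hq x) (hq1 x))
        (prefixProb_nonneg x)

theorem eventually_chanceLevel_sub_le (hp0 : 0 < p) (hp1 : p < 1)
    (T : SoftTransformer (Option Bool)) {δ : ℝ} (hδ : 0 < δ) :
    ∀ᶠ n : ℕ in atTop, chanceLevel (parityDist p) n - δ ≤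
      crossEntropy (parityDist p) n (fun x => T.predict x) := by
  have h := (tendsto_crossEntropy_sub_chanceCrossEntropy hp0 hp1 T).eventually_const_lt
    (show -δ < 0 by linarith)
  filter_upwards [h, eventually_ge_atTop 1] with n hn hn1
  obtain ⟨m, rfl⟩ : ∃ m, n = m + 1 := ⟨n - 1, by omega⟩
  have := chanceLevel_le_chanceCrossEntropy hp0 hp1 (m := m) (q := fun x => T.predict x)
    (fun x => T.predict_pos x) fun x => T.sum_predict x
  linarith

/-- The transformer that always predicts the distribution `q`. -/
def constTransformer {V : Type} (q : V → ℝ) : SoftTransformer V where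
  embDim := 0
  dim := 0
  layers := 0
  heads := 0
  embed _ := 0
  pos _ := 0
  pos_bounded := ⟨0, by simp⟩
  combine _ _ := 0
  combine_cont := continuous_const
  att _ _ _ _ := 0
  att_cont _ _ := continuous_const
  act _ _ _ := 0
  act_cont _ := continuous_const
  readout _ v := Real.log (q v)
  readout_cont := continuous_const

theorem predict_constTransformer {α : Type} [Fintype α] {q : Option α → ℝ} (hq : ∀ s, 0 < q s)
    (hq1 : ∑ s, q s = 1) {n : ℕ} (x : Fin n → α) : (constTransformer q).predict x = q := by
  ext s
  change Real.exp (Real.log (q s)) / ∑ s', Real.exp (Real.log (q s')) = q s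
  simp only [Real.exp_log (hq _), hq1, div_one]

theorem exists_tendsto_crossEntropy_sub_chanceLevel (hp0 : 0 < p) (hp1 : p < 1) :
    ∃ T : SoftTransformer (Option Bool),
      Tendsto (fun n : ℕ => crossEntropy (parityDist p) n (fun x => T.predict x) -
        chanceLevel (parityDist p) n) atTop (𝓝 0) := by
  refine ⟨constTransformer (parityMean p), tendsto_const_nhds.congr' ?_⟩
  -- From length 1 on the unigram distribution is exactly `parityMean`, so the difference is
  -- eventually zero.
  filter_upwards [eventually_ge_atTop 1] with n hn
  obtain ⟨m, rfl⟩ : ∃ m, n = m + 1 := ⟨n - 1, by omega⟩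
  simp only [predict_constTransformer (parityMean_pos hp0 hp1) sum_parityMean]
  rw [crossEntropy_const, chanceLevel_eq, unigram_parityDist hp0 hp1, sub_self]

end Parity

/-! ### 2Dyck -/

/-! ### Derivation trees of the 2Dyck grammar -/

namespace Derivation

/-- The height of a derivation tree. -/
def height : Derivation → ℕ
  | eps => 0
  | node _ l r => max (height l) (height r) + 1

theorem prob_nonneg {p : ℝ} (hp0 : 0 < p) (hp1 : p < 1) (d : Derivation) : 0 ≤ d.prob p := by
  induction d with
  | eps => simp only [prob]; linarith
  | node t l r hl hr => simp only [prob]; positivity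

/-- The grammar is unambiguous, also for derived words followed by a word that is empty or starts
with a closing bracket. -/
theorem eq_of_yield_append_eq {d d' : Derivation} {u u' : List Bracket}
    (hu : ∀ t v, u ≠ Bracket.opening t :: v) (hu' : ∀ t v, u' ≠ Bracket.opening t :: v)
    (h : d.yield ++ u = d'.yield ++ u') : d = d' ∧ u = u' := by
  induction d generalizing d' u u' with
  | eps =>
    cases d' with
    | eps => exact ⟨rfl, h⟩
    | node t l r => exact absurd h (hu _ _)
  | node t l r hl hr =>
    cases d' with
    | eps => exact absurd h.symm (hu' _ _)
    | node t' l' r' =>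
      simp only [yield, List.cons_append, List.append_assoc, List.cons.injEq,
        Bracket.opening.injEq] at h
      obtain ⟨rfl, h⟩ := h
      obtain ⟨rfl, h'⟩ := hl (by simp) (by simp) h
      obtain ⟨rfl, h''⟩ := hr hu hu' (List.cons.inj h').2
      exact ⟨rfl, h''⟩

theorem yield_injective : Function.Injective yield := fun d d' h =>
  (eq_of_yield_append_eq (u := []) (u' := []) (by simp) (by simp) (by simpa using h)).1

/-- A pair of matching brackets may be inserted anywhere in a derived word. -/
theorem exists_insert_pair (p : ℝ) (t : BracketType) (d : Derivation) (y v : List Bracket)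
    (h : d.yield = y ++ v) :
    ∃ d' : Derivation, d'.yield = y ++ Bracket.opening t :: Bracket.closing t :: v ∧
      d'.prob p = p * (1 - p) / 2 * d.prob p := by
  induction d generalizing y v with
  | eps =>
    simp only [yield, List.nil_eq, List.append_eq_nil_iff] at h
    obtain ⟨rfl, rfl⟩ := h
    exact ⟨node t eps eps, rfl, by simp only [prob]; ring⟩
  | node t' l r hl hr =>
    cases y with
    | nil =>
      refine ⟨node t eps (node t' l r), ?_, by simp only [prob]; ring⟩
      rw [List.nil_append] at h
      rw [← h]
      rfl
    | cons b y =>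
      simp only [yield, List.cons_append, List.cons.injEq] at h
      obtain ⟨rfl, h⟩ := h
      -- Locates the insertion point relative to the word of `l`. With `a` empty it lies just before
      -- the closing bracket, and the pair is still inserted into `l`.
      rcases List.append_eq_append_iff.1 h with ⟨a, rfl, ha⟩ | ⟨a, ha, rfl⟩
      · cases a with
        | nil =>
          obtain ⟨l', hy, hp⟩ := hl l.yield [] (by simp)
          refine ⟨node t' l' r, ?_, by simp only [prob, hp]; ring⟩
          rw [List.nil_append] at ha
          simp [yield, hy, ← ha]
        | cons b a =>
          obtain ⟨rfl, ha'⟩ := List.cons.inj ha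
          obtain ⟨r', hy, hp⟩ := hr a v ha'
          exact ⟨node t' l r', by simp [yield, hy], by simp only [prob, hp]; ring⟩
      · obtain ⟨l', hy, hp⟩ := hl y a ha
        exact ⟨node t' l' r, by simp [yield, hy], by simp only [prob, hp]; ring⟩

theorem tsum_eq (F : Derivation → ℝ≥0∞) :
    ∑' d, F d = F eps + ∑ t, ∑' l, ∑' r, F (node t l r) := by
  let e : Unit ⊕ BracketType × Derivation × Derivation ≃ Derivation :=
    { toFun := Sum.elim (fun _ => eps) fun z => node z.1 z.2.1 z.2.2
      invFun := fun d => match d with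
        | eps => .inl ()
        | node t l r => .inr (t, l, r)
      left_inv := by rintro (_ | ⟨t, l, r⟩) <;> rfl
      right_inv := by rintro (_ | ⟨t, l, r⟩) <;> rfl }
  simp only [← ENNReal.tsum_prod]
  rw [← e.tsum_eq, Summable.tsum_sum ENNReal.summable ENNReal.summable, tsum_fintype,
    ← tsum_fintype (L := .unconditional _) (fun t => ∑' z : Derivation × Derivation, _),
    ← ENNReal.tsum_prod]
  simp [e]

/-- If trees of height below N have mass at most 1, those of height below N + 1 have mass at most
`(1 - p) + p * 1 * 1`. Only finiteness matters, since all quantities are conditional. -/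
theorem tsum_prob_le_one {p : ℝ} (hp0 : 0 < p) (hp1 : p < 1) :
    ∑' d : Derivation, ENNReal.ofReal (d.prob p) ≤ 1 := by
  refine tsum_le_of_truncations
    (fun N d => if d.height < N then ENNReal.ofReal (d.prob p) else 0) height
    (fun N d h => by simp [h]) fun N => ?_
  induction N with
  | zero => simp
  | succ N ih =>
    have hnode : ∀ t l r, (if (node t l r).height < N + 1 then
        ENNReal.ofReal ((node t l r).prob p) else 0) = ENNReal.ofReal (p / 2) *
          ((if l.height < N then ENNReal.ofReal (l.prob p) else 0) *
            (if r.height < N then ENNReal.ofReal (r.prob p) else 0)) := by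
      intro t l r
      have hl := prob_nonneg hp0 hp1 l
      by_cases h1 : l.height < N <;> by_cases h2 : r.height < N <;>
        simp [height, h1, h2, prob]
      rw [ENNReal.ofReal_mul (by positivity), ENNReal.ofReal_mul (by positivity), mul_assoc]
    rw [tsum_eq]
    simp only [hnode, ENNReal.tsum_mul_left, ENNReal.tsum_mul_right]
    calc _ ≤ ENNReal.ofReal (1 - p) + ∑ _t : BracketType, ENNReal.ofReal (p / 2) * (1 * 1) := by
          refine add_le_add (by simp [height, prob]) (Finset.sum_le_sum fun t _ => ?_)
          gcongr
      _ = 1 := by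
          have hcard : Fintype.card BracketType = 2 := rfl
          rw [Finset.sum_const, Finset.card_univ, hcard, two_nsmul, mul_one, mul_one,
            ← ENNReal.ofReal_add (by positivity) (by positivity),
            ← ENNReal.ofReal_add (by linarith) (by positivity)]
          norm_num

end Derivation

/-- The stack of unmatched opening brackets after reading a word, starting from a given stack;
`none` if some closing bracket does not match. -/
def readBrackets : List BracketType → List Bracket → Option (List BracketType)
  | st, [] => some st
  | st, Bracket.opening t :: w => readBrackets (t :: st) w
  | [], Bracket.closing _ :: _ => none
  | t :: st, Bracket.closing t' :: w => if t = t' then readBrackets st w else none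

theorem readBrackets_append (st : List BracketType) (u v : List Bracket) :
    readBrackets st (u ++ v) = (readBrackets st u).bind fun st' => readBrackets st' v := by
  induction u generalizing st with
  | nil => rfl
  | cons b u ih =>
    cases b with
    | opening t => exact ih (t :: st)
    | closing t =>
      cases st with
      | nil => rfl
      | cons t' st =>
        simp only [List.cons_append, readBrackets]
        split_ifs
        · exact ih st
        · rfl

theorem readBrackets_yield (st : List BracketType) (d : Derivation) :
    readBrackets st d.yield = some st := by
  induction d generalizing st with
  | eps => rfl
  | node t l r hl hr =>
    simp [Derivation.yield, readBrackets, readBrackets_append, hl, hr]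

/-! ### Word and prefix masses for 2Dyck -/

section Dyck

variable {p : ℝ}

/-- The grammar is unambiguous, so the sum has a single term. -/
theorem dyckDist_yield (d : Derivation) : dyckDist p d.yield = ENNReal.ofReal (d.prob p) := by
  have : Unique {d' : Derivation // d'.yield = d.yield} :=
    ⟨⟨⟨d, rfl⟩⟩, fun d' => Subtype.ext (Derivation.yield_injective d'.2)⟩
  rw [dyckDist, tsum_eq_single ⟨d, rfl⟩ fun d' h => absurd (Subsingleton.elim _ _) h]

theorem dyckDist_eq_zero {w : List Bracket} (h : ∀ d : Derivation, d.yield ≠ w) :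
    dyckDist p w = 0 := by
  have : IsEmpty {d : Derivation // d.yield = w} := ⟨fun d => h d.1 d.2⟩
  rw [dyckDist, tsum_empty]

theorem mul_dyckDist_le_insert_pair (hp0 : 0 < p) (hp1 : p < 1) (t : BracketType)
    (y v : List Bracket) :
    ENNReal.ofReal (p * (1 - p) / 2) * dyckDist p (y ++ v) ≤
      dyckDist p (y ++ Bracket.opening t :: Bracket.closing t :: v) := by
  by_cases h : ∃ d : Derivation, d.yield = y ++ v
  · obtain ⟨d, hd⟩ := h
    obtain ⟨d', hd', hp⟩ := Derivation.exists_insert_pair p t d y v hd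
    have : 0 ≤ p * (1 - p) / 2 := by
      have : 0 < 1 - p := by linarith
      positivity
    rw [← hd, ← hd', dyckDist_yield, dyckDist_yield, hp, ENNReal.ofReal_mul this]
  · rw [dyckDist_eq_zero fun d hd => h ⟨d, hd⟩, mul_zero]
    exact zero_le

theorem tsum_dyckDist_le_one (hp0 : 0 < p) (hp1 : p < 1) : ∑' w, dyckDist p w ≤ 1 := by
  refine le_trans (le_of_eq ?_) (Derivation.tsum_prob_le_one hp0 hp1)
  rw [← (Equiv.sigmaFiberEquiv Derivation.yield).tsum_eq]
  exact (ENNReal.tsum_sigma fun (w : List Bracket) (d : {d : Derivation // d.yield = w}) =>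
    ENNReal.ofReal (d.1.prob p)).symm

/-- The prefix `y` followed by an opening bracket of type `t` and a pair of round brackets. -/
def dyckExtension {n : ℕ} (y : Fin n → Bracket) (t : BracketType) : Fin (n + 3) → Bracket :=
  Fin.snoc (α := fun _ => Bracket) (Fin.snoc (α := fun _ => Bracket)
    (Fin.snoc (α := fun _ => Bracket) y (Bracket.opening t))
      (Bracket.opening BracketType.round)) (Bracket.closing BracketType.round)

theorem ofFn_dyckExtension {n : ℕ} (y : Fin n → Bracket) (t : BracketType) :
    List.ofFn (dyckExtension y t) = List.ofFn y ++ [Bracket.opening t] ++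
      [Bracket.opening BracketType.round] ++ [Bracket.closing BracketType.round] := by
  simp only [dyckExtension, ofFn_snoc]

theorem dyckExtension_injective {n : ℕ} :
    Function.Injective fun z : (Fin n → Bracket) × BracketType => dyckExtension z.1 z.2 := by
  rintro ⟨y, t⟩ ⟨y', t'⟩ h
  obtain ⟨h, -⟩ := Fin.snoc_injective2 h
  obtain ⟨h, -⟩ := Fin.snoc_injective2 h
  obtain ⟨rfl, h⟩ := Fin.snoc_injective2 h
  exact Prod.ext rfl (Bracket.opening.inj h)

/-- The bracket type is visible only at the third position from the end. The padding pair keeps it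
off the last position, as prediction without an end-of-sequence symbol requires. -/
theorem dyckExtension_apply_eq {n : ℕ} (y : Fin n → Bracket) (t t' : BracketType)
    (j : Fin (n + 3)) (hj : j ≠ (Fin.last n).castSucc.castSucc) :
    dyckExtension y t j = dyckExtension y t' j := by
  revert hj
  refine Fin.lastCases (by simp [dyckExtension]) (fun j => ?_) j
  refine Fin.lastCases (by simp [dyckExtension]) (fun j => ?_) j
  refine Fin.lastCases (by simp) (fun j _ => ?_) j
  simp [dyckExtension]

theorem prefixMass_dyckExtension_le {n : ℕ} (y : Fin n → Bracket) (t : BracketType) :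
    prefixMass (dyckDist p) (List.ofFn (dyckExtension y t)) ≤
      prefixMass (dyckDist p) (List.ofFn y) := by
  rw [ofFn_dyckExtension]
  exact (prefixMass_append_singleton_le _ _ _).trans
    ((prefixMass_append_singleton_le _ _ _).trans (prefixMass_append_singleton_le _ _ _))

/-- A lower bound for the probability of closing the bracket opened by `dyckExtension`. -/
def closingBound (p : ℝ) : ℝ := (p * (1 - p) / 2) ^ 2

theorem closingBound_pos (hp0 : 0 < p) (hp1 : p < 1) : 0 < closingBound p := by
  have : 0 < 1 - p := by linarith
  unfold closingBound
  positivity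

/-- For each continuation `v`, insert a pair of type `t` after `y`, then a round pair inside it.
Each insertion costs `p * (1 - p) / 2`, whence the square in `closingBound`. -/
theorem mul_prefixMass_le_dyckExtension_closing (hp0 : 0 < p) (hp1 : p < 1) {n : ℕ}
    (y : Fin n → Bracket) (t : BracketType) :
    ENNReal.ofReal (closingBound p) * prefixMass (dyckDist p) (List.ofFn y) ≤
      prefixMass (dyckDist p) (List.ofFn (dyckExtension y t) ++ [Bracket.closing t]) := by
  have : 0 < 1 - p := by linarith
  simp only [prefixMass, ← ENNReal.tsum_mul_left]
  refine ENNReal.tsum_le_tsum fun v => ?_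
  rw [closingBound, sq, ENNReal.ofReal_mul (by positivity), mul_assoc, ofFn_dyckExtension]
  refine (mul_le_mul_right (mul_dyckDist_le_insert_pair hp0 hp1 t _ v) _).trans ?_
  have := mul_dyckDist_le_insert_pair hp0 hp1 BracketType.round
    (List.ofFn y ++ [Bracket.opening t]) (Bracket.closing t :: v)
  simpa using this

/-- If `y` is readable at all, the extension leaves `t` on top of the stack; a derived word never
meets a mismatch there. -/
theorem prefixMass_dyckExtension_closing_eq_zero {n : ℕ} (y : Fin n → Bracket)
    {t t' : BracketType} (h : t ≠ t') :
    prefixMass (dyckDist p) (List.ofFn (dyckExtension y t) ++ [Bracket.closing t']) = 0 := by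
  rw [prefixMass, ENNReal.tsum_eq_zero]
  refine fun v => dyckDist_eq_zero fun d hd => ?_
  have h1 := readBrackets_yield [] d
  rw [hd, ofFn_dyckExtension] at h1
  simp only [List.append_assoc, readBrackets_append [] (List.ofFn y)] at h1
  cases h2 : readBrackets [] (List.ofFn y) <;> simp [h2, readBrackets, h] at h1

theorem levelMass_dyckDist_ne_top (hp0 : 0 < p) (hp1 : p < 1) (n : ℕ) :
    levelMass (dyckDist p) n ≠ ⊤ :=
  levelMass_ne_top _ (ne_top_of_le_ne_top ENNReal.one_ne_top (tsum_dyckDist_le_one hp0 hp1)) n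

theorem prefixMass_dyckExtension_ne_zero (hp0 : 0 < p) (hp1 : p < 1) {n : ℕ}
    {y : Fin n → Bracket} (hy : prefixMass (dyckDist p) (List.ofFn y) ≠ 0) (t : BracketType) :
    prefixMass (dyckDist p) (List.ofFn (dyckExtension y t)) ≠ 0 := by
  intro h
  have h1 := (mul_prefixMass_le_dyckExtension_closing hp0 hp1 y t).trans
    (prefixMass_append_singleton_le _ _ _)
  rw [h] at h1
  exact mul_ne_zero (ENNReal.ofReal_pos.2 (closingBound_pos hp0 hp1)).ne' hy (nonpos_iff_eq_zero.1 h1)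

/-- Repeated extension of the empty prefix reaches every multiple of 3, and level masses decrease.
-/
theorem levelMass_dyckDist_ne_zero (hp0 : 0 < p) (hp1 : p < 1) (n : ℕ) :
    levelMass (dyckDist p) n ≠ 0 := by
  have hlevel : ∀ n, levelMass (dyckDist p) (3 * n) ≠ 0 := by
    intro n
    obtain ⟨y, hy⟩ : ∃ y : Fin (3 * n) → Bracket, prefixMass (dyckDist p) (List.ofFn y) ≠ 0 := by
      induction n with
      | zero =>
        refine ⟨Fin.elim0, fun h => ?_⟩
        rw [prefixMass, ENNReal.tsum_eq_zero] at h
        have h1 := h []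
        have h2 := dyckDist_yield (p := p) Derivation.eps
        simp only [List.ofFn_zero, List.append_nil] at h1
        rw [Derivation.yield, h1] at h2
        exact (ENNReal.ofReal_pos.2 (show 0 < 1 - p by linarith)).ne h2
      | succ n ih =>
        obtain ⟨y, hy⟩ := ih
        exact ⟨dyckExtension y BracketType.round,
          prefixMass_dyckExtension_ne_zero hp0 hp1 hy BracketType.round⟩
    exact fun h => hy (Finset.sum_eq_zero_iff.1 h y (Finset.mem_univ y))
  intro h
  have := antitone_nat_of_succ_le (levelMass_succ_le (dyckDist p)) (show n ≤ 3 * n by omega)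
  rw [h] at this
  exact hlevel n (nonpos_iff_eq_zero.1 this)

theorem closingBound_le_nextProb (hp0 : 0 < p) (hp1 : p < 1) {n : ℕ} {y : Fin n → Bracket}
    (hy : prefixMass (dyckDist p) (List.ofFn y) ≠ 0) (t : BracketType) :
    closingBound p ≤
      nextProb (dyckDist p) (List.ofFn (dyckExtension y t)) (some (Bracket.closing t)) := by
  have h0 := prefixMass_dyckExtension_ne_zero hp0 hp1 hy t
  have htop := ne_top_of_le_ne_top (levelMass_dyckDist_ne_top hp0 hp1 (n + 3))
    (prefixMass_ofFn_le (P := dyckDist p) (dyckExtension y t))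
  rw [nextProb, ← ENNReal.ofReal_le_iff_le_toReal]
  · rw [ENNReal.le_div_iff_mul_le (.inl h0) (.inl htop)]
    exact (mul_le_mul_right (prefixMass_dyckExtension_le y t) _).trans
      (mul_prefixMass_le_dyckExtension_closing hp0 hp1 y t)
  · exact ENNReal.div_ne_top
      (ne_top_of_le_ne_top htop (prefixMass_append_singleton_le _ _ _)) h0

theorem mul_le_prefixProb_dyckExtension (hp0 : 0 < p) (hp1 : p < 1) {n : ℕ} (y : Fin n → Bracket)
    (t : BracketType) :
    closingBound p * (prefixMass (dyckDist p) (List.ofFn y) /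
      levelMass (dyckDist p) (n + 3)).toReal ≤
      prefixProb (dyckDist p) (n + 3) (dyckExtension y t) := by
  have h1 := (mul_prefixMass_le_dyckExtension_closing hp0 hp1 y t).trans
    (prefixMass_append_singleton_le _ _ _)
  rw [← ENNReal.toReal_ofReal (closingBound_pos hp0 hp1).le, ← ENNReal.toReal_mul, ← mul_div_assoc]
  exact ENNReal.toReal_mono (ENNReal.div_ne_top (ne_top_of_le_ne_top
    (levelMass_dyckDist_ne_top hp0 hp1 (n + 3)) (prefixMass_ofFn_le _))
    (levelMass_dyckDist_ne_zero hp0 hp1 _)) (ENNReal.div_le_div_right h1 _)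

/-- Normalising by the smaller mass of level `n + 3` lets these weights dominate a probability
distribution on `y`. -/
theorem one_le_sum_prefixMass_div_levelMass (hp0 : 0 < p) (hp1 : p < 1) (n : ℕ) :
    1 ≤ ∑ y : Fin n → Bracket, (prefixMass (dyckDist p) (List.ofFn y) /
      levelMass (dyckDist p) (n + 3)).toReal := by
  have h0 := levelMass_dyckDist_ne_zero hp0 hp1 (n + 3)
  have htop := levelMass_dyckDist_ne_top hp0 hp1 n
  rw [← ENNReal.toReal_sum fun y _ => ENNReal.div_ne_top
    (ne_top_of_le_ne_top htop (prefixMass_ofFn_le y)) h0, ← ENNReal.toReal_one]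
  simp only [div_eq_mul_inv, ← Finset.sum_mul]
  change _ ≤ (levelMass (dyckDist p) n * _).toReal
  refine ENNReal.toReal_mono (ENNReal.mul_ne_top htop (ENNReal.inv_ne_top.2 h0)) ?_
  rw [← ENNReal.mul_inv_cancel h0 (levelMass_dyckDist_ne_top hp0 hp1 _)]
  gcongr
  exact antitone_nat_of_succ_le (levelMass_succ_le (dyckDist p)) (by omega)

/-- The relative entropy of the prediction `q` after the prefix `x`. -/
def excess {α : Type} [Fintype α] (P : List α → ℝ≥0∞) (x : List α) (q : Option α → ℝ) : ℝ :=
  ∑ s, nextProb P x s * (-Real.log (q s)) - ∑ s, nextProb P x s * (-Real.log (nextProb P x s))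

theorem crossEntropy_sub_optimalCrossEntropy {α : Type} [Fintype α] (P : List α → ℝ≥0∞) (n : ℕ)
    (q : (Fin n → α) → Option α → ℝ) :
    crossEntropy P n q - optimalCrossEntropy P n =
      ∑ x, prefixProb P n x * excess P (List.ofFn x) (q x) := by
  simp only [crossEntropy, optimalCrossEntropy, excess, mul_sub, Finset.sum_sub_distrib]

theorem sq_sqrt_sub_sqrt_le_excess {α : Type} [Fintype α] {P : List α → ℝ≥0∞} {x : List α}
    (h0 : prefixMass P x ≠ 0) (h : prefixMass P x ≠ ⊤) {q : Option α → ℝ} (hq : ∀ s, 0 < q s)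
    (hq1 : ∑ s, q s = 1) (s : Option α) :
    (√(nextProb P x s) - √(q s)) ^ 2 ≤ excess P x q :=
  (Finset.single_le_sum (f := fun s => (√(nextProb P x s) - √(q s)) ^ 2)
    (fun _ _ => sq_nonneg _) (Finset.mem_univ s)).trans
    (sum_sq_sqrt_sub_sqrt_le (nextProb_nonneg P x) (sum_nextProb h0 h) hq hq1)

/-- Similar predictions after the two prefixes that differ in the type of an open bracket cannot
both be good. -/
theorem closingBound_div_four_le_excess_add_excess (hp0 : 0 < p) (hp1 : p < 1) {n : ℕ}
    {y : Fin n → Bracket} (hy : prefixMass (dyckDist p) (List.ofFn y) ≠ 0)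
    {q : BracketType → Option Bracket → ℝ} (hq : ∀ t s, 0 < q t s) (hq1 : ∀ t, ∑ s, q t s = 1)
    (hqq : ∀ s, |q BracketType.round s - q BracketType.square s| ≤ closingBound p / 4) :
    closingBound p / 4 ≤
      excess (dyckDist p) (List.ofFn (dyckExtension y BracketType.round)) (q BracketType.round) +
      excess (dyckDist p) (List.ofFn (dyckExtension y BracketType.square)) (q BracketType.square) := by
  have htop : ∀ t, prefixMass (dyckDist p) (List.ofFn (dyckExtension y t)) ≠ ⊤ := fun t =>
    ne_top_of_le_ne_top (levelMass_dyckDist_ne_top hp0 hp1 (n + 3)) (prefixMass_ofFn_le _)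
  have h0 := prefixMass_dyckExtension_ne_zero hp0 hp1 hy
  set s : Option Bracket := some (Bracket.closing BracketType.round)
  have h1 := sq_sqrt_sub_sqrt_le_excess (h0 BracketType.round) (htop _) (hq BracketType.round)
    (hq1 _) s
  have h2 := sq_sqrt_sub_sqrt_le_excess (h0 BracketType.square) (htop _) (hq BracketType.square)
    (hq1 _) s
  have h3 := closingBound_le_nextProb hp0 hp1 hy BracketType.round
  have h4 : nextProb (dyckDist p) (List.ofFn (dyckExtension y BracketType.square)) s = 0 := by
    simp only [s, nextProb, prefixMass_dyckExtension_closing_eq_zero y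
      (show BracketType.square ≠ BracketType.round by simp), ENNReal.zero_div, ENNReal.toReal_zero]
  rw [h4, Real.sqrt_zero, zero_sub, neg_sq, Real.sq_sqrt (hq _ _).le] at h2
  have h5 := (abs_le.1 (hqq s)).2
  have h6 := Real.sq_sqrt (hq BracketType.round s).le
  have h7 := Real.sq_sqrt (nextProb_nonneg (dyckDist p)
    (List.ofFn (dyckExtension y BracketType.round)) s)
  -- With P the true probability and r the prediction for the round prefix, `(√P - √r)² + r = P/2 +
  -- (√P - 2√r)²/2`, which is at least half of `closingBound p`. Replacing r by the prediction for
  -- the square prefix costs a quarter.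
  nlinarith [sq_nonneg (√(nextProb (dyckDist p)
    (List.ofFn (dyckExtension y BracketType.round)) s) - 2 * √(q BracketType.round s))]

/-- One factor `closingBound p` bounds the share of extended prefixes; the other, divided by four,
bounds the excess on each pair. -/
theorem optimalCrossEntropy_dyckDist_add_le (hp0 : 0 < p) (hp1 : p < 1) {n : ℕ}
    {q : (Fin (n + 3) → Bracket) → Option Bracket → ℝ} (hq : ∀ x s, 0 < q x s)
    (hq1 : ∀ x, ∑ s, q x s = 1)
    (hqq : ∀ y s, |q (dyckExtension y BracketType.round) s -
      q (dyckExtension y BracketType.square) s| ≤ closingBound p / 4) :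
    optimalCrossEntropy (dyckDist p) (n + 3) + closingBound p * (closingBound p / 4) ≤
      crossEntropy (dyckDist p) (n + 3) q := by
  have hc := closingBound_pos hp0 hp1
  have htop := levelMass_dyckDist_ne_top hp0 hp1
  have hnonneg : ∀ x, prefixMass (dyckDist p) (List.ofFn x) ≠ 0 →
      0 ≤ excess (dyckDist p) (List.ofFn x) (q x) := fun x hx =>
    (sq_nonneg _).trans (sq_sqrt_sub_sqrt_le_excess hx
      (ne_top_of_le_ne_top (htop _) (prefixMass_ofFn_le x)) (hq x) (hq1 x) none)
  have hnonneg' : ∀ x, 0 ≤ prefixProb (dyckDist p) (n + 3) x *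
      excess (dyckDist p) (List.ofFn x) (q x) := fun x => by
    by_cases hx : prefixMass (dyckDist p) (List.ofFn x) = 0
    · simp only [prefixProb, hx, ENNReal.zero_div, ENNReal.toReal_zero, zero_mul, le_refl]
    · exact mul_nonneg (prefixProb_nonneg x) (hnonneg x hx)
  rw [← le_sub_iff_add_le', crossEntropy_sub_optimalCrossEntropy]
  have hpair : ∀ y : Fin n → Bracket,
      (prefixMass (dyckDist p) (List.ofFn y) / levelMass (dyckDist p) (n + 3)).toReal *
        (closingBound p * (closingBound p / 4)) ≤
      ∑ t, prefixProb (dyckDist p) (n + 3) (dyckExtension y t) *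
        excess (dyckDist p) (List.ofFn (dyckExtension y t)) (q (dyckExtension y t)) := by
    intro y
    by_cases hy : prefixMass (dyckDist p) (List.ofFn y) = 0
    · simp only [hy, ENNReal.zero_div, ENNReal.toReal_zero, zero_mul]
      exact Finset.sum_nonneg fun t _ => hnonneg' _
    have hkey := closingBound_div_four_le_excess_add_excess hp0 hp1 hy
      (q := fun t => q (dyckExtension y t)) (fun t => hq _) (fun t => hq1 _) (hqq y)
    have hsum : ∀ f : BracketType → ℝ, ∑ t, f t = f BracketType.round + f BracketType.square :=
      fun f => Finset.sum_pair (by simp)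
    calc _ = closingBound p * (prefixMass (dyckDist p) (List.ofFn y) /
            levelMass (dyckDist p) (n + 3)).toReal * (closingBound p / 4) := by ring
      _ ≤ closingBound p * (prefixMass (dyckDist p) (List.ofFn y) /
            levelMass (dyckDist p) (n + 3)).toReal *
          ∑ t, excess (dyckDist p) (List.ofFn (dyckExtension y t)) (q (dyckExtension y t)) := by
          rw [hsum]
          gcongr
      _ ≤ _ := by
          rw [Finset.mul_sum]
          refine Finset.sum_le_sum fun t _ => ?_
          exact mul_le_mul_of_nonneg_right (mul_le_prefixProb_dyckExtension hp0 hp1 y t)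
            (hnonneg _ (prefixMass_dyckExtension_ne_zero hp0 hp1 hy t))
  calc closingBound p * (closingBound p / 4)
      ≤ ∑ y : Fin n → Bracket, (prefixMass (dyckDist p) (List.ofFn y) /
          levelMass (dyckDist p) (n + 3)).toReal * (closingBound p * (closingBound p / 4)) := by
        rw [← Finset.sum_mul]
        exact le_mul_of_one_le_left (by positivity) (one_le_sum_prefixMass_div_levelMass hp0 hp1 n)
    _ ≤ ∑ y : Fin n → Bracket, ∑ t, prefixProb (dyckDist p) (n + 3) (dyckExtension y t) *
          excess (dyckDist p) (List.ofFn (dyckExtension y t)) (q (dyckExtension y t)) :=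
        Finset.sum_le_sum fun y _ => hpair y
    -- Distinct pairs `(y, t)` give distinct prefixes, so this is part of the full sum, whose other
    -- terms are nonnegative.
    _ = ∑ x ∈ Finset.univ.map ⟨_, dyckExtension_injective⟩,
          prefixProb (dyckDist p) (n + 3) x * excess (dyckDist p) (List.ofFn x) (q x) := by
        rw [Finset.sum_map, Fintype.sum_prod_type]
        rfl
    _ ≤ _ := Finset.sum_le_univ_sum_of_nonneg hnonneg'

/-! ### 2Dyck: transformers against the optimum -/

theorem eventually_optimalCrossEntropy_add_le_predict (hp0 : 0 < p) (hp1 : p < 1)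
    (T : SoftTransformer (Option Bracket)) :
    ∀ᶠ n : ℕ in atTop, optimalCrossEntropy (dyckDist p) n +
      closingBound p * (closingBound p / 4) ≤
        crossEntropy (dyckDist p) n (fun x => T.predict x) := by
  have hc := closingBound_pos hp0 hp1
  obtain ⟨N, hN⟩ := T.exists_predict_stable (g := id) continuousOn_id
    (show 0 < closingBound p / 4 by positivity)
  filter_upwards [eventually_ge_atTop (N + 3)] with n hn
  obtain ⟨m, rfl⟩ : ∃ m, n = m + 3 := ⟨n - 3, by omega⟩
  exact optimalCrossEntropy_dyckDist_add_le hp0 hp1 (fun x => T.predict_pos x)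
    (fun x => T.sum_predict x) fun y s => hN (m + 3) (by omega) _ _
      (Fin.last m).castSucc.castSucc (dyckExtension_apply_eq y _ _) s

theorem eventually_optimalCrossEntropy_add_le_predictBare (hp0 : 0 < p) (hp1 : p < 1)
    (T : SoftTransformer (Option Bracket)) :
    ∀ᶠ m : ℕ in atTop, optimalCrossEntropy (dyckDist p) (m + 1) +
      closingBound p * (closingBound p / 4) ≤
        crossEntropy (dyckDist p) (m + 1) (fun x => T.predictBare x) := by
  have hc := closingBound_pos hp0 hp1
  obtain ⟨N, hN⟩ := T.exists_output_stable (g := id) continuousOn_id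
    (show 0 < closingBound p / 4 by positivity)
  filter_upwards [eventually_ge_atTop (N + 2)] with n hn
  -- Here the prefix has length `n + 1`, so a shift by 2 yields the `m + 3` letters of
  -- `dyckExtension`.
  obtain ⟨m, rfl⟩ : ∃ m, n = m + 2 := ⟨n - 2, by omega⟩
  exact optimalCrossEntropy_dyckDist_add_le hp0 hp1 (fun x s => softmax_pos _ _)
    (fun x => sum_softmax _) fun y s => hN (m + 2) (by omega) _ _
      (Fin.last m).castSucc.castSucc (Fin.castSucc_lt_last _).ne
      (fun j hj => congrArg some (dyckExtension_apply_eq y _ _ j hj)) s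

end Dyck

end SoftAttention

end

theorem theorem2 (p : ℝ) (hp0 : 0 < p) (hp1 : p < 1) :
    -- Parity
    ((∀ T : SoftAttention.SoftTransformer (Option Bool),
        Tendsto (fun n : ℕ =>
            SoftAttention.crossEntropy (SoftAttention.parityDist p) n (fun x => T.predict x) -
              SoftAttention.chanceCrossEntropy (SoftAttention.parityDist p) n
                (fun x => T.predict x))
          atTop (𝓝 0) ∧
        ∀ δ : ℝ, 0 < δ → ∀ᶠ n : ℕ in atTop,
          SoftAttention.chanceLevel (SoftAttention.parityDist p) n - δ ≤
            SoftAttention.crossEntropy (SoftAttention.parityDist p) n (fun x => T.predict x)) ∧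
      ∃ T : SoftAttention.SoftTransformer (Option Bool),
        Tendsto (fun n : ℕ =>
            SoftAttention.crossEntropy (SoftAttention.parityDist p) n (fun x => T.predict x) -
              SoftAttention.chanceLevel (SoftAttention.parityDist p) n)
          atTop (𝓝 0)) ∧
    -- 2Dyck
    (∃ ε : ℝ, 0 < ε ∧ ∀ T : SoftAttention.SoftTransformer (Option SoftAttention.Bracket),
        (∀ᶠ n : ℕ in atTop,
          SoftAttention.optimalCrossEntropy (SoftAttention.dyckDist p) n + ε ≤
            SoftAttention.crossEntropy (SoftAttention.dyckDist p) n (fun x => T.predict x)) ∧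
        ∀ᶠ m : ℕ in atTop,
          SoftAttention.optimalCrossEntropy (SoftAttention.dyckDist p) (m + 1) + ε ≤
            SoftAttention.crossEntropy (SoftAttention.dyckDist p) (m + 1)
              (fun x => T.predictBare x)) := by
  exact ⟨⟨fun T => ⟨SoftAttention.tendsto_crossEntropy_sub_chanceCrossEntropy hp0 hp1 T,
      fun _ hδ => SoftAttention.eventually_chanceLevel_sub_le hp0 hp1 T hδ⟩,
      SoftAttention.exists_tendsto_crossEntropy_sub_chanceLevel hp0 hp1⟩,
    SoftAttention.closingBound p * (SoftAttention.closingBound p / 4),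
    mul_pos (SoftAttention.closingBound_pos hp0 hp1)
      (div_pos (SoftAttention.closingBound_pos hp0 hp1) four_pos),
    fun T => ⟨SoftAttention.eventually_optimalCrossEntropy_add_le_predict hp0 hp1 T,
      SoftAttention.eventually_optimalCrossEntropy_add_le_predictBare hp0 hp1 T⟩⟩
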